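/- Let $l\ge 1$, $k=\mathbb C(\sqrt q)$ with $q$ an indeterminate, and let $P=\bigoplus_{i=1}^l\mathbb Z\beta_i$ carry the bilinear form $(\cdot,\cdot)$ for which $\beta_1,\dots,\beta_l$ is orthonormal. Put $\beta_{l+1}=0$, $\alpha_i=\beta_i-\beta_{i+1}$ and $w_l=\beta_1+\dots+\beta_l$; the $\alpha_i$ form a basis of $P$. Put $q_i=q^{(\alpha_i,\alpha_i)/2}$ and $\langle\alpha_j,\alpha_i\rangle=2(\alpha_j,\alpha_i)/(\alpha_i,\alpha_i)$. Let $U$ be the $k$-algebra generated by $E_i,F_i$ ($1\le i\le l$) and $K_\mu$ ($\mu\in P$) with the relations $K_0=1$, $K_\lambda K_\mu=K_{\lambda+\mu}$, $K_\lambda E_jK_\lambda^{-1}=q^{(\lambda,\alpha_j)}E_j$, $K_\lambda F_jK_\lambda^{-1}=q^{-(\lambda,\alpha_j)}F_j$, $E_iF_j-F_jE_i=\delta_{ij}\frac{K_{\alpha_i}-K_{\alpha_i}^{-1}}{q-q^{-1}}$ and, for $i\ne j$ and $N=1-\langle\alpha_j,\alpha_i\rangle$, the quantum Serre relations $\sum_{m=0}^{N}(-1)^m\binom{N}{m}_{q_i}E_i^{N-m}E_jE_i^m=0$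 and $\sum_{m=0}^{N}(-1)^m\binom{N}{m}_{q_i}F_i^{N-m}F_jF_i^m=0$ (with symmetric Gaussian binomial coefficients). It is a Hopf algebra for $$\Delta(K_\lambda)=K_\lambda\otimes K_\lambda,\quad \Delta(E_i)=E_i\otimes1+K_{\alpha_i}\otimes E_i,\quad \Delta(F_i)=F_i\otimes K_{\alpha_i}^{-1}+1\otimes F_i,$$ $$\varepsilon(K_\lambda)=1,\quad \varepsilon(E_i)=\varepsilon(F_i)=0,\quad S(K_\lambda)=K_\lambda^{-1},\quad S(E_i)=-K_{\alpha_i}^{-1}E_i,\quad S(F_i)=-F_iK_{\alpha_i}.$$ The multiplicative group $\Gamma=\{\xi_\mu\}\simeq P/2P$ acts on $U$ by $\xi_\mu\cdot u=(-1)^{(\mu,\nu)}u$ for $u$ of weight $\nu$, that is, if $K_\lambda uK_\lambda^{-1}=q^{(\nu,\lambda)}u$ for all $\lambda\in P$. Let $\tilde U=U\rtimes k\Gamma$, a Hopf algebra with $\Delta,\varepsilon,S$ extended by $\Delta(\xi_\mu)=\xi_\mu\otimes\xi_\mu$, $\varepsilon(\xi_\mu)=1$, $S(\xi_\mu)=\xi_\mu$.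 The algebra $\tilde U$ has the following gradations: by the weights $\nu\in P$ (defined as for $U$); the $P/2P$-gradation $\mu$ with $\mu(\xi_\lambda)=0$, $\mu(K_\lambda)=\lambda$, $\mu(E_i)=\beta_{i+1}$, $\mu(F_i)=\beta_i$; the $P/2P$-gradation $\delta$ with $\delta(\xi_\lambda)=\delta(E_i)=0$, $\delta(K_\lambda)=\lambda$, $\delta(F_i)=\alpha_i$; and the $\mathbb Z/2$-gradation $\tilde U_{|i}=\{x:\ \xi x\xi=(-1)^ix\}$, where $\xi=\xi_{w_l}$. Let $\Psi:\tilde U\to\tilde U$ be the linear involution with $\Psi(x)=\xi_{\mu(x)}x$ for $\mu$-homogeneous $x$, and let $\eta:P\to P/2P$ be the morphism $\sum n_i\alpha_i\mapsto\sum n_i\beta_{i+1}$. Define linear maps $\overline\Delta:\tilde U\to\tilde U\otimes\tilde U$ and $\overline S:\tilde U\to\tilde U$ by $$\overline\Delta(\Psi(a))=\sum(-1)^{(\nu(a_1),\,\nu(a_2)+\eta(\nu(a_2)))}\,\Psi(a_1)\otimes\Psi(a_2),\qquad \overline S(\Psi(a))=(-1)^{(\nu(a),\delta(a))}\,\Psi(S(a))$$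 for $a$ homogeneous for $\nu$ and $\delta$, where $\Delta(a)=\sum a_1\otimes a_2$ with homogeneous $a_1,a_2$. **Lemma.** $(\tilde U,\overline\Delta,\overline S,\varepsilon)$ is a Hopf superalgebra for the $\mathbb Z/2$-gradation above: $\overline\Delta$, $\varepsilon$, $\overline S$ are even, $\overline\Delta$ and $\varepsilon$ are morphisms of superalgebras, where $\tilde U\otimes\tilde U$ has the product $(a\otimes b)(a'\otimes b')=(-1)^{|b||a'|}aa'\otimes bb'$, $\overline\Delta$ is coassociative with counit $\varepsilon$, and $\overline S$ is an antipode. Moreover $\Psi(U)$ is a Hopf sub-superalgebra: it is a $\mathbb Z/2$-graded unital subalgebra with $\overline\Delta(\Psi(U))\subseteq\Psi(U)\otimes\Psi(U)$ and $\overline S(\Psi(U))\subseteq\Psi(U)$. -/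

import Mathlib

namespace ZhangOsp

open scoped TensorProduct DirectSum

noncomputable section

/-! ### Hopf superalgebras -/

section Super

variable {k A : Type*} [Field k] [Ring A] [Algebra k A]

/-- The `k`-superalgebra `A = 𝒜 0 ⊕ 𝒜 1`, with the linear maps `Δ`, `ε`, `S`, is a Hopf superalgebra:
the three maps are even, `Δ` and `ε` are morphisms of unital superalgebras, where `A ⊗ A` carries the
product `(a ⊗ b) (a' ⊗ b') = (-1) ^ (|b| |a'|) a a' ⊗ b b'` (this is Mathlib's graded tensor
product), `Δ` is coassociative with counit `ε`, and `S` is an antipode. -/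
structure IsHopfSuperalgebra (𝒜 : ZMod 2 → Submodule k A) [GradedAlgebra 𝒜]
    (Δ : A →ₗ[k] A ⊗[k] A) (ε : A →ₗ[k] k) (S : A →ₗ[k] A) : Prop where
  comul_even : ∀ i, ∀ a ∈ 𝒜 i,
    Δ a ∈ ⨆ j : ZMod 2, LinearMap.range (TensorProduct.map (𝒜 j).subtype (𝒜 (i - j)).subtype)
  comul_one : Δ 1 = 1 ⊗ₜ 1
  comul_mul : ∀ a b, GradedTensorProduct.of k 𝒜 𝒜 (Δ (a * b)) =
    GradedTensorProduct.of k 𝒜 𝒜 (Δ a) * GradedTensorProduct.of k 𝒜 𝒜 (Δ b)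
  counit_even : ∀ a ∈ 𝒜 1, ε a = 0
  counit_one : ε 1 = 1
  counit_mul : ∀ a b, ε (a * b) = ε a * ε b
  coassoc : ∀ a, TensorProduct.assoc k A A A (Δ.rTensor A (Δ a)) = Δ.lTensor A (Δ a)
  counit_comul : ∀ a, TensorProduct.lid k A (ε.rTensor A (Δ a)) = a
  comul_counit : ∀ a, TensorProduct.rid k A (ε.lTensor A (Δ a)) = a
  antipode_even : ∀ i, ∀ a ∈ 𝒜 i, S a ∈ 𝒜 i
  antipode_left : ∀ a, LinearMap.mul' k A (S.rTensor A (Δ a)) = algebraMap k A (ε a)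
  antipode_right : ∀ a, LinearMap.mul' k A (S.lTensor A (Δ a)) = algebraMap k A (ε a)

/-- The subspace `B` of the superalgebra `A` is a Hopf sub-superalgebra for the coproduct `Δ` and the
antipode `S`: a graded unital subalgebra with `Δ B ⊆ B ⊗ B` and `S B ⊆ B`. -/
structure IsHopfSubsuperalgebra (𝒜 : ZMod 2 → Submodule k A) [GradedAlgebra 𝒜]
    (Δ : A →ₗ[k] A ⊗[k] A) (S : A →ₗ[k] A) (B : Submodule k A) : Prop where
  one_mem : (1 : A) ∈ B
  mul_mem : ∀ a ∈ B, ∀ b ∈ B, a * b ∈ B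
  homogeneous : ∀ b ∈ B, ∀ i, (DirectSum.decompose 𝒜 b i : A) ∈ B
  comul_mem : ∀ b ∈ B, Δ b ∈ LinearMap.range (TensorProduct.map B.subtype B.subtype)
  antipode_mem : ∀ b ∈ B, S b ∈ B

end Super

/-! ### The root datum -/

/-- The lattice `P = ℤ β₁ ⊕ ⋯ ⊕ ℤ β_l`, which is the weight lattice and the root lattice of
`osp(1,2l)`. -/
abbrev P (l : ℕ) : Type := Fin l → ℤ

/-- The quotient `P / 2P`, in the coordinates given by the basis `β`. -/
abbrev Q (l : ℕ) : Type := Fin l → ZMod 2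

/-- The projection `P → P / 2P`. -/
def red (l : ℕ) : P l →+ Q l where
  toFun v := fun i => (v i : ZMod 2)
  map_zero' := by ext; simp
  map_add' u v := by ext; simp

lemma red_surjective (l : ℕ) : Function.Surjective (red l) := fun θ =>
  ⟨fun i => ((θ i).val : ℤ), by ext i; simp [red]⟩

lemma red_eq_zero_iff {l : ℕ} (v : P l) : red l v = 0 ↔ ∃ u : P l, v = 2 • u := by
  constructor
  · intro h
    have h' : ∀ i, (2 : ℤ) ∣ v i := fun i =>
      (ZMod.intCast_zmod_eq_zero_iff_dvd (v i) 2).1 (congrFun h i)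
    choose u hu using h'
    exact ⟨u, by ext i; simp [hu i]⟩
  · rintro ⟨u, rfl⟩
    rw [map_nsmul]
    ext i
    simp [CharTwo.two_eq_zero]

variable {l : ℕ}

/-- The symmetric bilinear form on `P` for which the `β i` are orthonormal. -/
def form (u v : P l) : ℤ := ∑ i, u i * v i

/-- The form induced on `P / 2P`, with values in `ℤ / 2ℤ`. -/
def formQ (u v : Q l) : ZMod 2 := ∑ i, u i * v i

lemma form_red (u v : P l) : ((form u v : ℤ) : ZMod 2) = formQ (red l u) (red l v) := by
  simp [form, formQ, red]

lemma form_comm (u v : P l) : form u v = form v u := by simp [form, mul_comm]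
lemma form_add_left (u v w : P l) : form (u + v) w = form u w + form v w := by
  simp [form, add_mul, Finset.sum_add_distrib]
lemma form_add_right (u v w : P l) : form u (v + w) = form u v + form u w := by
  simp [form, mul_add, Finset.sum_add_distrib]
lemma form_neg_left (u v : P l) : form (-u) v = -form u v := by simp [form]
lemma form_neg_right (u v : P l) : form u (-v) = -form u v := by simp [form]
lemma form_zero_left (v : P l) : form 0 v = 0 := by simp [form]
lemma form_zero_right (v : P l) : form v 0 = 0 := by simp [form]
lemma formQ_add_left (u v w : Q l) : formQ (u + v) w = formQ u w + formQ v w := by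
  simp [formQ, add_mul, Finset.sum_add_distrib]
lemma formQ_add_right (u v w : Q l) : formQ u (v + w) = formQ u v + formQ u w := by
  simp [formQ, mul_add, Finset.sum_add_distrib]
lemma formQ_zero_left (v : Q l) : formQ 0 v = 0 := by simp [formQ]
lemma formQ_zero_right (v : Q l) : formQ v 0 = 0 := by simp [formQ]

/-- The basis vector `β_i`. -/
def β (i : Fin l) : P l := Pi.single i 1

/-- The vector `β_{i+1}`, with the convention `β_{l+1} = 0`. -/
def βsucc (i : Fin l) : P l := if h : (i : ℕ) + 1 < l then β ⟨i + 1, h⟩ else 0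

/-- The simple root `α_i = β_i - β_{i+1}`. -/
def α (i : Fin l) : P l := β i - βsucc i

/-- `w_i = β_1 + ⋯ + β_i`. -/
def w (i : Fin l) : P l := ∑ j ∈ Finset.Iic i, β j

/-- `w_l = β_1 + ⋯ + β_l`. -/
def wlast (l : ℕ) : P l := ∑ j : Fin l, β j

lemma form_β (u : P l) (i : Fin l) : form u (β i) = u i := by
  simp [form, β, Pi.single_apply]

lemma form_sum_right {ι : Type*} (u : P l) (s : Finset ι) (f : ι → P l) :
    form u (∑ j ∈ s, f j) = ∑ j ∈ s, form u (f j) := by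
  classical
  induction s using Finset.induction_on with
  | empty => simp [form_zero_right]
  | insert a s ha ih => rw [Finset.sum_insert ha, Finset.sum_insert ha, form_add_right, ih]

lemma form_w (u : P l) (i : Fin l) : form u (w i) = ∑ j ∈ Finset.Iic i, u j := by
  simp [w, form_sum_right, form_β]

lemma βsucc_apply (i j : Fin l) : βsucc i j = if (i : ℕ) + 1 = j then 1 else 0 := by
  unfold βsucc β
  split_ifs with h h' h' <;> simp [Pi.single_apply, Fin.ext_iff] <;> omega

/-- The numbers `n_i = (v, w_i)` are the coordinates of `v` in the basis of simple roots. -/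
lemma eq_sum_form_w (v : P l) : v = ∑ i, form v (w i) • α i := by
  ext m
  simp only [Finset.sum_apply, Pi.smul_apply, α, Pi.sub_apply, βsucc_apply, β, Pi.single_apply,
    smul_eq_mul, mul_sub, Finset.sum_sub_distrib, mul_ite, mul_one, mul_zero, form_w]
  rw [Finset.sum_ite_eq Finset.univ m, if_pos (Finset.mem_univ m)]
  obtain ⟨m, hm⟩ := m
  cases m with
  | zero =>
    have : (Finset.Iic (⟨0, hm⟩ : Fin l)) = {⟨0, hm⟩} := by
      ext j; simp [Fin.ext_iff, Fin.le_def]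
    simp [this]
  | succ m =>
    have h1 : (Finset.Iic (⟨m + 1, hm⟩ : Fin l)) =
        insert ⟨m + 1, hm⟩ (Finset.Iic (⟨m, by omega⟩ : Fin l)) := by
      ext j; simp [Fin.ext_iff, Fin.le_def]; omega
    have h2 : ∀ i : Fin l, ((i : ℕ) + 1 = m + 1) ↔ (i = ⟨m, by omega⟩) := by
      intro i; simp [Fin.ext_iff]
    rw [h1, Finset.sum_insert (by simp [Fin.le_def])]
    simp only [h2]
    rw [Finset.sum_ite_eq' Finset.univ]
    simp

/-- The map `η : P → P / 2P`, `η (∑ n_i α_i) = ∑ n_i β_{i+1}`; the coefficient `n_i` of `v` on `α_i`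
is `(v, w_i)`. -/
def η (v : P l) : Q l := ∑ i, (form v (w i) : ZMod 2) • red l (βsucc i)

lemma η_add (u v : P l) : η (u + v) = η u + η v := by
  simp [η, form_add_left, add_smul, Finset.sum_add_distrib]

lemma form_α_w (i j : Fin l) : form (α i) (w j) = if i = j then 1 else 0 := by
  simp only [form_w, α, Pi.sub_apply, Finset.sum_sub_distrib, β, Pi.single_apply, βsucc_apply]
  rw [Finset.sum_ite_eq' (Finset.Iic j)]
  have h : ∑ x ∈ Finset.Iic j, (if (i : ℕ) + 1 = x then (1 : ℤ) else 0) = if i < j then 1 else 0 := by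
    split_ifs with hij
    · rw [Finset.sum_eq_single (⟨i + 1, by omega⟩ : Fin l)]
      · simp
      · intro b _ hb
        rw [if_neg]
        intro h; exact hb (Fin.ext h.symm)
      · intro hb
        exact absurd (Finset.mem_Iic.2 (by rw [Fin.le_def]; simp; omega)) hb
    · refine Finset.sum_eq_zero fun x hx => ?_
      rw [if_neg]
      rw [Finset.mem_Iic] at hx
      omega
  rw [h]
  simp only [Finset.mem_Iic]
  split_ifs <;> first | rfl | omega

lemma η_α (i : Fin l) : η (α i) = red l (βsucc i) := by
  simp [η, form_α_w]

lemma form_α_α (i j : Fin l) : form (α i) (α j) =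
    (if i = j then (if (i : ℕ) + 1 < l then 2 else 1) else 0) -
      (if (i : ℕ) + 1 = j then 1 else 0) - (if (j : ℕ) + 1 = i then 1 else 0) := by
  have h1 : ∀ a b : Fin l, form (βsucc a) (βsucc b) =
      if a = b then (if (a : ℕ) + 1 < l then 1 else 0) else 0 := by
    intro a b
    conv_lhs => rw [βsucc]
    split_ifs with h h' h'
    · rw [form_comm, form_β, βsucc_apply]; simp [h']
    · rw [form_comm, form_β, βsucc_apply]; simp; omega
    · rw [form_zero_left]
    · rw [form_zero_left]
  rw [α, α, sub_eq_add_neg, sub_eq_add_neg, form_add_left, form_add_right, form_add_right,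
    form_neg_left, form_neg_right, form_neg_right, form_neg_left, h1, form_β, form_β,
    form_comm, form_β, βsucc_apply, βsucc_apply, β, Pi.single_apply]
  split_ifs <;> omega

/-! ### The ground field and the quantum numbers -/

/-- The field `k = ℂ(√q)`. -/
abbrev kk : Type := RatFunc ℂ

/-- The indeterminate `√q`. -/
def sqrtq : kk := RatFunc.X

/-- The element `q` of `k`. -/
def q : kk := sqrtq ^ 2

lemma sqrtq_ne_zero : sqrtq ≠ 0 := RatFunc.X_ne_zero
lemma q_ne_zero : q ≠ 0 := pow_ne_zero _ sqrtq_ne_zero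

lemma sqrtq_pow_ne_one {n : ℕ} (hn : n ≠ 0) : sqrtq ^ n ≠ 1 := by
  intro h
  have h2 : algebraMap (Polynomial ℂ) (RatFunc ℂ) (Polynomial.X ^ n) =
      algebraMap (Polynomial ℂ) (RatFunc ℂ) 1 := by
    simpa [sqrtq] using h
  have h3 := RatFunc.algebraMap_injective ℂ h2
  have h4 := congrArg Polynomial.natDegree h3
  simp at h4
  exact hn h4

lemma q_zpow_injective : Function.Injective (fun n : ℤ => q ^ n) := by
  have key : ∀ n : ℕ, n ≠ 0 → q ^ n ≠ 1 := by
    intro n hn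
    rw [q, ← pow_mul]
    exact sqrtq_pow_ne_one (by omega)
  have key2 : ∀ n : ℤ, q ^ n = 1 → n = 0 := by
    intro n h
    by_contra hn
    rcases Int.natAbs_eq n with h' | h'
    · rw [h', zpow_natCast] at h
      exact key _ (by omega) h
    · rw [h', zpow_neg, zpow_natCast, inv_eq_one] at h
      exact key _ (by omega) h
  intro a b h
  have h1 : q ^ (a - b) = 1 := by
    rw [zpow_sub₀ q_ne_zero]
    exact (div_eq_one_iff_eq (zpow_ne_zero _ q_ne_zero)).2 h
  have := key2 _ h1
  omega

/-- `[n]_ν = (ν^n - ν^{-n}) / (ν - ν⁻¹)`. -/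
def qint (ν : kk) (n : ℕ) : kk := (ν ^ n - ν⁻¹ ^ n) / (ν - ν⁻¹)

/-- `[n]_ν! = [n]_ν ⋯ [1]_ν`. -/
def qfact (ν : kk) (n : ℕ) : kk := ∏ m ∈ Finset.range n, qint ν (m + 1)

/-- The quantum binomial coefficient, for `m ≤ n`. -/
def qbinom (ν : kk) (n m : ℕ) : kk := qfact ν n / (qfact ν m * qfact ν (n - m))

/-- `q_i = q ^ ((α_i, α_i) / 2)`. -/
def qi (i : Fin l) : kk := sqrtq ^ form (α i) (α i)

/-- `⟨u, v⟩ = 2 (u, v) / (v, v)`; the division is exact for `u`, `v` simple roots. -/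
def cartan (u v : P l) : ℤ := 2 * form u v / form v v

/-- The degree `1 - ⟨α_j, α_i⟩` in the quantum Serre relation; it is positive for `i ≠ j`. -/
def serreDeg (i j : Fin l) : ℕ := (1 - cartan (α j) (α i)).toNat

section Serre

variable {A : Type*} [Ring A] [Algebra kk A]

/-- The left hand side of the quantum Serre relation. -/
def serre (i j : Fin l) (X : Fin l → A) : A :=
  ∑ m ∈ Finset.range (serreDeg i j + 1), ((-1) ^ m * qbinom (qi i) (serreDeg i j) m) •
    (X i ^ (serreDeg i j - m) * X j * X i ^ m)

lemma serre_cases {i j : Fin l} (h : i ≠ j) :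
    (form (α i) (α j) = 0 ∧ serreDeg i j = 1) ∨
    (form (α i) (α j) = -1 ∧ form (α i) (α i) = 2 ∧ serreDeg i j = 2) ∨
    (form (α i) (α j) = -1 ∧ form (α i) (α i) = 1 ∧ serreDeg i j = 3) := by
  have h1 := form_α_α i j
  have h2 := form_α_α i i
  have h3 := form_α_α j i
  have hl : (i : ℕ) < l := i.2
  have hl' : (j : ℕ) < l := j.2
  have hij : (i : ℕ) ≠ j := fun e => h (Fin.ext e)
  rw [if_neg h] at h1
  rw [if_neg h.symm] at h3
  replace h2 : form (α i) (α i) = if (i : ℕ) + 1 < l then 2 else 1 := by rw [h2]; simp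
  unfold serreDeg cartan
  by_cases ha : (i : ℕ) + 1 = j
  · have e1 : form (α i) (α j) = -1 := by rw [h1, if_pos ha, if_neg (by omega)]; rfl
    have e2 : form (α i) (α i) = 2 := by rw [h2, if_pos (by omega)]
    right; left
    rw [form_comm (α j), e1, e2]
    decide
  by_cases hb : (j : ℕ) + 1 = i
  · have e1 : form (α i) (α j) = -1 := by rw [h1, if_pos hb, if_neg (by omega)]; rfl
    right
    by_cases hc : (i : ℕ) + 1 < l
    · have e2 : form (α i) (α i) = 2 := by rw [h2, if_pos hc]
      left
      rw [form_comm (α j), e1, e2]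
      decide
    · have e2 : form (α i) (α i) = 1 := by rw [h2, if_neg hc]
      right
      rw [form_comm (α j), e1, e2]
      decide
  · have e1 : form (α i) (α j) = 0 := by rw [h1, if_neg hb, if_neg ha]; rfl
    left
    rw [form_comm (α j), e1]
    simp

lemma sub_inv_ne_zero {ν : kk} (h : ν ≠ 0) (h2 : ν ^ 2 ≠ 1) : ν - ν⁻¹ ≠ 0 := by
  intro h'
  apply h2
  rw [sub_eq_zero] at h'
  calc ν ^ 2 = ν * ν := pow_two ν
    _ = ν * ν⁻¹ := by rw [← h']
    _ = 1 := mul_inv_cancel₀ h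

lemma qint_one {ν : kk} (h : ν ≠ 0) (h2 : ν ^ 2 ≠ 1) : qint ν 1 = 1 := by
  simp [qint, div_self (sub_inv_ne_zero h h2)]

lemma qint_two {ν : kk} (h : ν ≠ 0) (h2 : ν ^ 2 ≠ 1) : qint ν 2 = ν + ν⁻¹ := by
  rw [qint, div_eq_iff (sub_inv_ne_zero h h2)]
  ring

lemma qint_three {ν : kk} (h : ν ≠ 0) (h2 : ν ^ 2 ≠ 1) : qint ν 3 = ν ^ 2 + 1 + ν⁻¹ ^ 2 := by
  rw [qint, div_eq_iff (sub_inv_ne_zero h h2)]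
  field_simp
  ring

lemma qi_pow_ne_one (i : Fin l) {n : ℕ} (hn : n ≠ 0) : qi i ^ n ≠ 1 := by
  have h : 0 < form (α i) (α i) := by
    rw [form_α_α i i]
    simp only [if_true, Nat.succ_ne_self, if_false]
    split_ifs <;> norm_num
  obtain ⟨m, hm⟩ := Int.eq_ofNat_of_zero_le h.le
  rw [qi, hm, zpow_natCast, ← pow_mul]
  exact sqrtq_pow_ne_one (mul_ne_zero (by omega) hn)

lemma qi_ne_zero (i : Fin l) : qi i ≠ 0 := zpow_ne_zero _ sqrtq_ne_zero

lemma qi_two_ne_zero (i : Fin l) : qi i + (qi i)⁻¹ ≠ 0 := by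
  intro h
  have h0 := qi_ne_zero i
  apply qi_pow_ne_one i (n := 4) (by norm_num)
  field_simp at h
  linear_combination (qi i ^ 2 - 1) * h

lemma qi_three_ne_zero (i : Fin l) : qi i ^ 2 + 1 + (qi i)⁻¹ ^ 2 ≠ 0 := by
  intro h
  have h0 := qi_ne_zero i
  apply qi_pow_ne_one i (n := 6) (by norm_num)
  field_simp at h
  linear_combination (qi i ^ 2 - 1) * h

lemma serre_one {i j : Fin l} (h : serreDeg i j = 1) (X : Fin l → A) :
    serre i j X = X i * X j - X j * X i := by
  have h0 := qi_ne_zero i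
  have h2 := qi_pow_ne_one i (n := 2) two_ne_zero
  simp [serre, h, Finset.sum_range_succ, qbinom, qfact, qint_one h0 h2, sub_eq_add_neg]

lemma serre_two {i j : Fin l} (h : serreDeg i j = 2) (X : Fin l → A) :
    serre i j X = X i * X i * X j - (qi i + (qi i)⁻¹) • (X i * X j * X i) + X j * X i * X i := by
  have h0 := qi_ne_zero i
  have h2 := qi_pow_ne_one i (n := 2) two_ne_zero
  have h4 := qi_two_ne_zero i
  simp [serre, h, Finset.sum_range_succ, qbinom, qfact, Finset.prod_range_succ, qint_one h0 h2,
    qint_two h0 h2, h4, sub_eq_add_neg, pow_two, mul_assoc]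
  rw [← neg_smul, neg_add_rev]

lemma serre_three {i j : Fin l} (h : serreDeg i j = 3) (X : Fin l → A) :
    serre i j X = X i * X i * X i * X j - (qi i ^ 2 + 1 + (qi i)⁻¹ ^ 2) • (X i * X i * X j * X i) +
      (qi i ^ 2 + 1 + (qi i)⁻¹ ^ 2) • (X i * X j * X i * X i) - X j * X i * X i * X i := by
  have h0 := qi_ne_zero i
  have h2 := qi_pow_ne_one i (n := 2) two_ne_zero
  have h4 := qi_two_ne_zero i
  have h6 := qi_three_ne_zero i
  have e1 : (qi i + (qi i)⁻¹) * (qi i ^ 2 + 1 + (qi i)⁻¹ ^ 2) / (qi i + (qi i)⁻¹) =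
    (qi i ^ 2 + 1 + (qi i)⁻¹ ^ 2) := mul_div_cancel_left₀ _ h4
  have e2 : (qi i + (qi i)⁻¹) * (qi i ^ 2 + 1 + (qi i)⁻¹ ^ 2) / ((qi i + (qi i)⁻¹) *
    (qi i ^ 2 + 1 + (qi i)⁻¹ ^ 2)) = 1 := div_self (mul_ne_zero h4 h6)
  rw [serre, h]
  simp only [Finset.sum_range_succ, Finset.sum_range_zero, qbinom, qfact, Finset.prod_range_succ,
    Finset.prod_range_zero, zero_add, one_add_one_eq_two, show (2 : ℕ) + 1 = 3 from rfl,
    show (3 : ℕ) - 0 = 3 from rfl, show (3 : ℕ) - 1 = 2 from rfl, show (3 : ℕ) - 2 = 1 from rfl,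
    show (3 : ℕ) - 3 = 0 from rfl, qint_one h0 h2, qint_two h0 h2, qint_three h0 h2, one_mul,
    mul_one, e1, e2]
  simp only [pow_succ, pow_zero, one_mul, mul_one, neg_mul, neg_neg, one_smul, neg_smul, mul_assoc,
    sub_eq_add_neg]

/-- If the words of the Serre relation are mapped to each other by a linear map, up to a common
scalar, so are the two sides of the relation. -/
lemma serre_map {B : Type*} [Ring B] [Algebra kk B] {i j : Fin l} (X : Fin l → A) (Y : Fin l → B)
    (f : A →ₗ[kk] B) (hf : ∀ m ≤ serreDeg i j, Y i ^ (serreDeg i j - m) * Y j * Y i ^ m =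
      f (X i ^ (serreDeg i j - m) * X j * X i ^ m)) : serre i j Y = f (serre i j X) := by
  rw [serre, serre, map_sum]
  refine Finset.sum_congr rfl fun m hm => ?_
  rw [map_smul, hf m (by simpa [Nat.lt_succ_iff] using hm)]

lemma serre_hom {B : Type*} [Ring B] [Algebra kk B] (i j : Fin l) (X : Fin l → A)
    (f : A →ₐ[kk] B) : serre i j (fun a => f (X a)) = f (serre i j X) :=
  serre_map X _ f.toLinearMap fun m _ => by simp

lemma serre_op {i j : Fin l} (hij : i ≠ j) (X : Fin l → A) (hX : serre i j X = 0) :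
    serre i j (fun a => MulOpposite.op (X a)) = 0 := by
  apply MulOpposite.unop_injective
  rcases serre_cases hij with ⟨_, h⟩ | ⟨_, _, h⟩ | ⟨_, _, h⟩
  · rw [serre_one h] at hX ⊢
    simp only [MulOpposite.unop_sub, MulOpposite.unop_mul, MulOpposite.unop_op,
      MulOpposite.unop_zero]
    rw [← neg_eq_zero, ← hX]
    abel
  · rw [serre_two h] at hX ⊢
    simp only [MulOpposite.unop_sub, MulOpposite.unop_add, MulOpposite.unop_smul,
      MulOpposite.unop_mul, MulOpposite.unop_op, MulOpposite.unop_zero]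
    rw [← hX]
    simp only [mul_assoc]
    abel
  · rw [serre_three h] at hX ⊢
    simp only [MulOpposite.unop_sub, MulOpposite.unop_add, MulOpposite.unop_smul,
      MulOpposite.unop_mul, MulOpposite.unop_op, MulOpposite.unop_zero]
    rw [← neg_eq_zero, ← hX]
    simp only [mul_assoc]
    abel

lemma serre_add_aux_two {k B : Type*} [Field k] [Ring B] [Algebra k B] {t : k} (ht : t ≠ 0)
    {a b c d : B} (h1 : c * a = t ^ 2 • (a * c)) (h2 : d * a = t⁻¹ • (a * d))
    (h3 : c * b = t⁻¹ • (b * c))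
    (hX : a * a * b - (t + t⁻¹) • (a * b * a) + b * a * a = 0)
    (hY : c * c * d - (t + t⁻¹) • (c * d * c) + d * c * c = 0) :
    (a + c) * (a + c) * (b + d) - (t + t⁻¹) • ((a + c) * (b + d) * (a + c)) +
      (b + d) * (a + c) * (a + c) = 0 := by
  have key : ∀ {x y : B} {t : k}, y * x = t • (x * y) → ∀ z, y * (x * z) = t • (x * (y * z)) := by
    intro x y t h z
    rw [← mul_assoc, h, smul_mul_assoc, mul_assoc]
  have h1' := key h1
  have h2' := key h2
  have h3' := key h3
  have hXY := congrArg₂ (· + ·) hX hY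
  simp only [add_zero] at hXY
  rw [← hXY]
  simp only [add_mul, mul_add, mul_assoc, h1, h2, h3, h1', h2', h3', smul_mul_assoc,
    mul_smul_comm, smul_add, smul_smul]
  match_scalars <;> field_simp <;> ring

lemma serre_add_aux_three {k B : Type*} [Field k] [Ring B] [Algebra k B] {t : k} (ht : t ≠ 0)
    {a b c d : B} (h1 : c * a = t ^ 2 • (a * c)) (h2 : d * a = (t ^ 2)⁻¹ • (a * d))
    (h3 : c * b = (t ^ 2)⁻¹ • (b * c))
    (hX : a * a * a * b - (t ^ 2 + 1 + t⁻¹ ^ 2) • (a * a * b * a) +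
      (t ^ 2 + 1 + t⁻¹ ^ 2) • (a * b * a * a) - b * a * a * a = 0)
    (hY : c * c * c * d - (t ^ 2 + 1 + t⁻¹ ^ 2) • (c * c * d * c) +
      (t ^ 2 + 1 + t⁻¹ ^ 2) • (c * d * c * c) - d * c * c * c = 0) :
    (a + c) * (a + c) * (a + c) * (b + d) -
      (t ^ 2 + 1 + t⁻¹ ^ 2) • ((a + c) * (a + c) * (b + d) * (a + c)) +
      (t ^ 2 + 1 + t⁻¹ ^ 2) • ((a + c) * (b + d) * (a + c) * (a + c)) -
      (b + d) * (a + c) * (a + c) * (a + c) = 0 := by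
  have key : ∀ {x y : B} {t : k}, y * x = t • (x * y) → ∀ z, y * (x * z) = t • (x * (y * z)) := by
    intro x y t h z
    rw [← mul_assoc, h, smul_mul_assoc, mul_assoc]
  have h1' := key h1
  have h2' := key h2
  have h3' := key h3
  have hXY := congrArg₂ (· + ·) hX hY
  simp only [add_zero] at hXY
  rw [← hXY]
  simp only [add_mul, mul_add, mul_assoc, h1, h2, h3, h1', h2', h3', smul_mul_assoc,
    mul_smul_comm, smul_add, smul_smul]
  match_scalars <;> field_simp <;> ring

/-- The quantum Serre relation for a sum of two `q`-commuting solutions. -/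
lemma serre_add {i j : Fin l} (hij : i ≠ j) (X Y : Fin l → A)
    (hX : serre i j X = 0) (hY : serre i j Y = 0)
    (hYX : ∀ a b, Y b * X a = q ^ form (α b) (α a) • (X a * Y b)) :
    serre i j (fun a => X a + Y a) = 0 := by
  have h1 := hYX i i
  have h2 := hYX i j
  have h3 := hYX j i
  rw [form_comm (α j)] at h2
  rcases serre_cases hij with ⟨e, h⟩ | ⟨e, e', h⟩ | ⟨e, e', h⟩
  · rw [serre_one h] at hX hY ⊢
    rw [e, zpow_zero, one_smul] at h2 h3
    rw [add_mul, add_mul, mul_add, mul_add, mul_add, mul_add, h2, h3]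
    calc _ = (X i * X j - X j * X i) + (Y i * Y j - Y j * Y i) := by abel
      _ = 0 := by rw [hX, hY, add_zero]
  · rw [serre_two h] at hX hY ⊢
    rw [e, zpow_neg_one] at h2 h3
    rw [e'] at h1
    have hq : qi i = q := by rw [qi, e', q]; rfl
    rw [hq] at hX hY ⊢
    exact serre_add_aux_two q_ne_zero h1 h2 h3 hX hY
  · rw [serre_three h] at hX hY ⊢
    rw [e, zpow_neg_one] at h2 h3
    rw [e', zpow_one] at h1
    have hq : qi i = sqrtq := by rw [qi, e', zpow_one]
    rw [hq] at hX hY ⊢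
    exact serre_add_aux_three sqrtq_ne_zero h1 h2 h3 hX hY

end Serre

/-! ### The algebra `U` -/

/-- The symbols `E_i`, `F_i`, `K_μ`. -/
inductive Gen (l : ℕ) : Type
  | E (i : Fin l)
  | F (i : Fin l)
  | K (μ : P l)

/-- The free algebra on the symbols `E_i`, `F_i`, `K_μ`. -/
abbrev Free (l : ℕ) : Type := FreeAlgebra kk (Gen l)

/-- The generators `E_i` of the free algebra. -/
def fE (i : Fin l) : Free l := FreeAlgebra.ι kk (Gen.E i)
/-- The generators `F_i` of the free algebra. -/
def fF (i : Fin l) : Free l := FreeAlgebra.ι kk (Gen.F i)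
/-- The generators `K_μ` of the free algebra. -/
def fK (μ : P l) : Free l := FreeAlgebra.ι kk (Gen.K μ)

/-- The defining relations of `U`. In view of the first two, `K_{-μ}` is the inverse of `K_μ`. -/
inductive Rel (l : ℕ) : Free l → Free l → Prop
  | K_zero : Rel l (fK 0) 1
  | K_add (μ ν : P l) : Rel l (fK μ * fK ν) (fK (μ + ν))
  | K_E (μ : P l) (j : Fin l) : Rel l (fK μ * fE j * fK (-μ)) (q ^ form μ (α j) • fE j)
  | K_F (μ : P l) (j : Fin l) : Rel l (fK μ * fF j * fK (-μ)) (q ^ (-form μ (α j)) • fF j)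
  | E_F (i j : Fin l) : Rel l (fE i * fF j - fF j * fE i)
      (if i = j then (q - q⁻¹)⁻¹ • (fK (α i) - fK (-α i)) else 0)
  | serre_E (i j : Fin l) (h : i ≠ j) : Rel l (serre i j fE) 0
  | serre_F (i j : Fin l) (h : i ≠ j) : Rel l (serre i j fF) 0

/-- The algebra `U`, generated by the `E_i`, `F_i`, `K_μ` subject to the relations `Rel`. -/
def U (l : ℕ) : Type := RingQuot (Rel l)

instance : Ring (U l) := inferInstanceAs (Ring (RingQuot (Rel l)))
instance : Algebra kk (U l) := inferInstanceAs (Algebra kk (RingQuot (Rel l)))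

/-- The projection of the free algebra onto `U`. -/
def mkU (l : ℕ) : Free l →ₐ[kk] U l := RingQuot.mkAlgHom kk (Rel l)

/-- The generator `E_i` of `U`. -/
def uE (i : Fin l) : U l := mkU l (fE i)
/-- The generator `F_i` of `U`. -/
def uF (i : Fin l) : U l := mkU l (fF i)
/-- The generator `K_μ` of `U`. -/
def uK (μ : P l) : U l := mkU l (fK μ)

/-- The families `E`, `F`, `K` in an algebra satisfy the defining relations of `U`. -/
structure IsRep {A : Type*} [Ring A] [Algebra kk A] (E F : Fin l → A) (K : P l → A) : Prop where
  K_zero : K 0 = 1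
  K_add : ∀ μ ν, K μ * K ν = K (μ + ν)
  K_E : ∀ μ j, K μ * E j = q ^ form μ (α j) • (E j * K μ)
  K_F : ∀ μ j, K μ * F j = q ^ (-form μ (α j)) • (F j * K μ)
  E_F : ∀ i j, E i * F j - F j * E i =
    if i = j then (q - q⁻¹)⁻¹ • (K (α i) - K (-α i)) else 0
  serre_E : ∀ i j, i ≠ j → serre i j E = 0
  serre_F : ∀ i j, i ≠ j → serre i j F = 0

lemma isRep_U (l : ℕ) : IsRep (uE (l := l)) uF uK := by
  have hr : ∀ {x y : Free l}, Rel l x y → mkU l x = mkU l y := fun h => RingQuot.mkAlgHom_rel kk h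
  have K_zero : uK (l := l) 0 = 1 := by simpa [uK] using hr Rel.K_zero
  have K_add : ∀ μ ν : P l, uK μ * uK ν = uK (μ + ν) := fun μ ν => by
    simpa [uK] using hr (Rel.K_add μ ν)
  have hinv : ∀ μ : P l, uK (-μ) * uK μ = 1 := fun μ => by rw [K_add, neg_add_cancel, K_zero]
  refine ⟨K_zero, K_add, fun μ j => ?_, fun μ j => ?_, fun i j => ?_, fun i j h => ?_,
    fun i j h => ?_⟩
  · have h := hr (Rel.K_E μ j)
    rw [map_mul, map_mul, map_smul] at h
    change uK μ * uE j * uK (-μ) = _ • uE j at h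
    rw [← smul_mul_assoc, ← h, mul_assoc _ (uK (-μ)), hinv, mul_one]
  · have h := hr (Rel.K_F μ j)
    rw [map_mul, map_mul, map_smul] at h
    change uK μ * uF j * uK (-μ) = _ • uF j at h
    rw [← smul_mul_assoc, ← h, mul_assoc _ (uK (-μ)), hinv, mul_one]
  · have h := hr (Rel.E_F i j)
    rw [map_sub, map_mul, map_mul, apply_ite (mkU l), map_smul, map_sub, map_zero] at h
    exact h
  · have h := hr (Rel.serre_E i j h)
    rw [← serre_hom, map_zero] at h
    exact h
  · have h := hr (Rel.serre_F i j h)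
    rw [← serre_hom, map_zero] at h
    exact h

section Lift

variable {A : Type*} [Ring A] [Algebra kk A] {E F : Fin l → A} {K : P l → A}

/-- The morphism from the free algebra with prescribed values on the generators. -/
def liftFree (E F : Fin l → A) (K : P l → A) : Free l →ₐ[kk] A :=
  FreeAlgebra.lift kk (fun g => match g with
    | Gen.E i => E i
    | Gen.F i => F i
    | Gen.K μ => K μ)

lemma liftFree_E (i : Fin l) : liftFree E F K (fE i) = E i := by simp [liftFree, fE]
lemma liftFree_F (i : Fin l) : liftFree E F K (fF i) = F i := by simp [liftFree, fF]
lemma liftFree_K (μ : P l) : liftFree E F K (fK μ) = K μ := by simp [liftFree, fK]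

lemma liftFree_rel (h : IsRep E F K) ⦃x y : Free l⦄ (hxy : Rel l x y) :
    liftFree E F K x = liftFree E F K y := by
  have hinv : ∀ μ : P l, K μ * K (-μ) = 1 := fun μ => by rw [h.K_add, add_neg_cancel, h.K_zero]
  have hE : (fun i => liftFree E F K (fE i)) = E := funext liftFree_E
  have hF : (fun i => liftFree E F K (fF i)) = F := funext liftFree_F
  cases hxy with
  | K_zero => rw [liftFree_K, map_one, h.K_zero]
  | K_add μ ν => rw [map_mul, liftFree_K, liftFree_K, liftFree_K, h.K_add]
  | K_E μ j =>
    rw [map_mul, map_mul, map_smul, liftFree_K, liftFree_K, liftFree_E, h.K_E, smul_mul_assoc,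
      mul_assoc, hinv, mul_one]
  | K_F μ j =>
    rw [map_mul, map_mul, map_smul, liftFree_K, liftFree_K, liftFree_F, h.K_F, smul_mul_assoc,
      mul_assoc, hinv, mul_one]
  | E_F i j =>
    rw [map_sub, map_mul, map_mul, apply_ite (liftFree E F K), map_smul, map_sub, map_zero,
      liftFree_E, liftFree_F, liftFree_K, liftFree_K, ← h.E_F]
  | serre_E i j hij => rw [← serre_hom, hE, map_zero, h.serre_E i j hij]
  | serre_F i j hij => rw [← serre_hom, hF, map_zero, h.serre_F i j hij]

/-- The morphism `U → A` with prescribed values on the generators. -/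
def liftU (h : IsRep E F K) : U l →ₐ[kk] A :=
  RingQuot.liftAlgHom kk ⟨liftFree E F K, liftFree_rel h⟩

lemma liftU_mk (h : IsRep E F K) (x : Free l) : liftU h (mkU l x) = liftFree E F K x :=
  RingQuot.liftAlgHom_mkAlgHom_apply kk _ _ _

@[simp] lemma liftU_E (h : IsRep E F K) (i : Fin l) : liftU h (uE i) = E i := by
  rw [uE, liftU_mk, liftFree_E]
@[simp] lemma liftU_F (h : IsRep E F K) (i : Fin l) : liftU h (uF i) = F i := by
  rw [uF, liftU_mk, liftFree_F]
@[simp] lemma liftU_K (h : IsRep E F K) (μ : P l) : liftU h (uK μ) = K μ := by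
  rw [uK, liftU_mk, liftFree_K]

end Lift

lemma U_induction {p : U l → Prop} (hE : ∀ i, p (uE i)) (hF : ∀ i, p (uF i)) (hK : ∀ μ, p (uK μ))
    (hc : ∀ c : kk, p (algebraMap kk (U l) c)) (hadd : ∀ a b, p a → p b → p (a + b))
    (hmul : ∀ a b, p a → p b → p (a * b)) (u : U l) : p u := by
  obtain ⟨x, rfl⟩ := RingQuot.mkAlgHom_surjective kk (Rel l) u
  change p (mkU l x)
  induction x using FreeAlgebra.induction with
  | grade0 c => rw [AlgHom.commutes]; exact hc c
  | grade1 g =>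
    cases g with
    | E i => exact hE i
    | F i => exact hF i
    | K μ => exact hK μ
  | mul a b ha hb => rw [map_mul]; exact hmul _ _ ha hb
  | add a b ha hb => rw [map_add]; exact hadd _ _ ha hb

lemma U_hom_ext {A : Type*} [Ring A] [Algebra kk A] {f g : U l →ₐ[kk] A}
    (hE : ∀ i, f (uE i) = g (uE i)) (hF : ∀ i, f (uF i) = g (uF i))
    (hK : ∀ μ, f (uK μ) = g (uK μ)) : f = g := by
  ext u
  induction u using U_induction with
  | hE i => exact hE i
  | hF i => exact hF i
  | hK μ => exact hK μ
  | hc c => rw [AlgHom.commutes, AlgHom.commutes]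
  | hadd a b ha hb => rw [map_add, map_add, ha, hb]
  | hmul a b ha hb => rw [map_mul, map_mul, ha, hb]

/-! ### The Hopf structure of `U` -/

lemma serre_word_comm {A : Type*} [Ring A] (Y : P l → A)
    (hY : ∀ μ ν, Y μ * Y ν = Y (μ + ν)) (hY0 : Y 0 = 1) (i j : Fin l) (m : ℕ)
    (hm : m ≤ serreDeg i j) :
    Y (α i) ^ (serreDeg i j - m) * Y (α j) * Y (α i) ^ m = Y (serreDeg i j • α i + α j) := by
  have hp : ∀ (μ : P l) (n : ℕ), Y μ ^ n = Y (n • μ) := by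
    intro μ n
    induction n with
    | zero => simp [hY0]
    | succ n ih => rw [pow_succ, ih, hY, succ_nsmul]
  rw [hp, hp, hY, hY]
  congr 1
  obtain ⟨d, hd⟩ := Nat.exists_eq_add_of_le hm
  rw [hd, Nat.add_sub_cancel_left, add_nsmul]
  abel

lemma serre_scale {A : Type*} [Ring A] [Algebra kk A] {i j : Fin l} (X : Fin l → A) (c : Fin l → kk)
    (hX : serre i j X = 0) : serre i j (fun a => c a • X a) = 0 := by
  rw [serre_map X _ ((c i ^ serreDeg i j * c j) • LinearMap.id), hX, map_zero]
  intro m hm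
  simp only [smul_pow, smul_mul_assoc, mul_smul_comm, smul_smul, LinearMap.smul_apply,
    LinearMap.id_apply]
  congr 1
  obtain ⟨d, hd⟩ := Nat.exists_eq_add_of_le hm
  rw [hd, Nat.add_sub_cancel_left, pow_add]
  ring

lemma serre_twist_aux {k B : Type*} [Field k] [Ring B] [Algebra k B] {s r c : k} {g h e f : B}
    (hg : h * g = g * h) (h1 : e * g = s • (g * e)) (h2 : e * h = r • (h * e))
    (h3 : f * g = r • (g * f)) :
    ((g * e) * (h * f) - (h * f) * (g * e) = r • (g * (h * (e * f - f * e)))) ∧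
    ((g * e) * (g * e) * (h * f) - c • ((g * e) * (h * f) * (g * e)) + (h * f) * (g * e) * (g * e) =
      (s * r ^ 2) • (g * (g * (h * (e * e * f - c • (e * f * e) + f * e * e))))) ∧
    ((g * e) * (g * e) * (g * e) * (h * f) - c • ((g * e) * (g * e) * (h * f) * (g * e)) +
      c • ((g * e) * (h * f) * (g * e) * (g * e)) - (h * f) * (g * e) * (g * e) * (g * e) =
      (s ^ 3 * r ^ 3) • (g * (g * (g * (h * (e * e * e * f - c • (e * e * f * e) +
        c • (e * f * e * e) - f * e * e * e)))))) := by
  have key : ∀ {x y : B} {t : k}, y * x = t • (x * y) → ∀ z, y * (x * z) = t • (x * (y * z)) := by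
    intro x y t h z
    rw [← mul_assoc, h, smul_mul_assoc, mul_assoc]
  have h1' := key h1
  have h2' := key h2
  have h3' := key h3
  have hg' : ∀ z, h * (g * z) = g * (h * z) := fun z => by rw [← mul_assoc, hg, mul_assoc]
  refine ⟨?_, ?_, ?_⟩ <;>
  · simp only [mul_add, mul_sub, mul_assoc, h1', h2', h3', hg', smul_mul_assoc,
      mul_smul_comm, smul_add, smul_sub, smul_smul]
    try (match_scalars <;> ring)

lemma serre_twist {A : Type*} [Ring A] [Algebra kk A] {i j : Fin l} (hij : i ≠ j)
    (X Y : Fin l → A) (hYY : ∀ a b, Y a * Y b = Y b * Y a)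
    (hXY : ∀ a b, X a * Y b = q ^ form (α a) (α b) • (Y b * X a)) (hX : serre i j X = 0) :
    serre i j (fun a => Y a * X a) = 0 := by
  have h3 := hXY j i
  rw [form_comm] at h3
  have aux : ∀ c : kk, _ := fun c => serre_twist_aux (c := c) (hYY j i) (hXY i i) (hXY i j) h3
  rcases serre_cases hij with ⟨_, h⟩ | ⟨_, _, h⟩ | ⟨_, _, h⟩
  · rw [serre_one h] at hX ⊢
    rw [(aux 0).1, hX, mul_zero, mul_zero, smul_zero]
  · rw [serre_two h] at hX ⊢
    rw [(aux _).2.1, hX, mul_zero, mul_zero, mul_zero, smul_zero]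
  · rw [serre_three h] at hX ⊢
    rw [(aux _).2.2, hX, mul_zero, mul_zero, mul_zero, mul_zero, smul_zero]

lemma isRep_counit (l : ℕ) : IsRep (A := kk) (fun _ : Fin l => 0) (fun _ => 0) (fun _ => 1) := by
  have hs : ∀ i j : Fin l, serre i j (fun _ => (0 : kk)) = 0 := fun i j => by
    rw [serre]
    refine Finset.sum_eq_zero fun m _ => ?_
    rw [mul_zero, zero_mul, smul_zero]
  exact ⟨rfl, by simp, by simp, by simp, by simp, fun i j _ => hs i j, fun i j _ => hs i j⟩

/-- The counit of `U`: `E_i ↦ 0`, `F_i ↦ 0`, `K_μ ↦ 1`. -/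
def counitU (l : ℕ) : U l →ₐ[kk] kk := liftU (isRep_counit l)

lemma K_inv_mul (μ : P l) : uK (-μ) * uK μ = 1 := by
  rw [(isRep_U l).K_add, neg_add_cancel, (isRep_U l).K_zero]

lemma K_mul_inv (μ : P l) : uK μ * uK (-μ) = 1 := by
  rw [(isRep_U l).K_add, add_neg_cancel, (isRep_U l).K_zero]

lemma uK_comm (μ ν : P l) : uK μ * uK ν = uK ν * uK μ := by
  rw [(isRep_U l).K_add, (isRep_U l).K_add, add_comm]

lemma uE_mul_uK (μ : P l) (i : Fin l) : uE i * uK μ = q ^ (-form μ (α i)) • (uK μ * uE i) := by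
  rw [(isRep_U l).K_E, smul_smul, ← zpow_add₀ q_ne_zero, neg_add_cancel, zpow_zero, one_smul]

lemma uF_mul_uK (μ : P l) (i : Fin l) : uF i * uK μ = q ^ form μ (α i) • (uK μ * uF i) := by
  rw [(isRep_U l).K_F, smul_smul, ← zpow_add₀ q_ne_zero, add_neg_cancel, zpow_zero, one_smul]

lemma isRep_comul (l : ℕ) : IsRep (A := U l ⊗[kk] U l)
    (fun i => uE i ⊗ₜ 1 + uK (α i) ⊗ₜ uE i) (fun i => uF i ⊗ₜ uK (-α i) + 1 ⊗ₜ uF i)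
    (fun μ => uK μ ⊗ₜ uK μ) where
  K_zero := by rw [(isRep_U l).K_zero]; rfl
  K_add μ ν := by rw [Algebra.TensorProduct.tmul_mul_tmul, (isRep_U l).K_add]
  K_E μ j := by
    rw [mul_add, add_mul, Algebra.TensorProduct.tmul_mul_tmul, Algebra.TensorProduct.tmul_mul_tmul,
      Algebra.TensorProduct.tmul_mul_tmul, Algebra.TensorProduct.tmul_mul_tmul, (isRep_U l).K_E,
      uK_comm μ, mul_one, one_mul, TensorProduct.tmul_smul, ← TensorProduct.smul_tmul', smul_add]
  K_F μ j := by
    rw [mul_add, add_mul, Algebra.TensorProduct.tmul_mul_tmul, Algebra.TensorProduct.tmul_mul_tmul,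
      Algebra.TensorProduct.tmul_mul_tmul, Algebra.TensorProduct.tmul_mul_tmul, (isRep_U l).K_F,
      uK_comm μ, mul_one, one_mul, TensorProduct.tmul_smul, ← TensorProduct.smul_tmul', smul_add]
  E_F i j := by
    have h1 := (isRep_U l).E_F i j
    have h2 : (uK (α i) * uF j) ⊗ₜ[kk] (uE i * uK (-α j)) =
        (uF j * uK (α i)) ⊗ₜ[kk] (uK (-α j) * uE i) := by
      rw [(isRep_U l).K_F, (isRep_U l).K_E, TensorProduct.tmul_smul, TensorProduct.smul_tmul',
        form_neg_left, form_comm]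
    have h3 : (uE i ⊗ₜ[kk] 1 + uK (α i) ⊗ₜ[kk] uE i) * (uF j ⊗ₜ[kk] uK (-α j) + 1 ⊗ₜ[kk] uF j) -
        (uF j ⊗ₜ[kk] uK (-α j) + 1 ⊗ₜ[kk] uF j) * (uE i ⊗ₜ[kk] 1 + uK (α i) ⊗ₜ[kk] uE i) =
        (uE i * uF j - uF j * uE i) ⊗ₜ[kk] uK (-α j) +
          uK (α i) ⊗ₜ[kk] (uE i * uF j - uF j * uE i) := by
      simp only [mul_add, add_mul, Algebra.TensorProduct.tmul_mul_tmul, one_mul, mul_one, h2,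
        TensorProduct.sub_tmul, TensorProduct.tmul_sub]
      abel
    rw [h3, h1]
    split_ifs with h
    · subst h
      simp only [TensorProduct.tmul_smul, ← TensorProduct.smul_tmul', TensorProduct.sub_tmul,
        TensorProduct.tmul_sub, ← smul_add]
      congr 1
      abel
    · simp
  serre_E i j hij := by
    refine serre_add hij _ _ ?_ ?_ ?_
    · rw [show (fun a => uE a ⊗ₜ[kk] (1 : U l)) = fun a =>
        (Algebra.TensorProduct.includeLeft : U l →ₐ[kk] U l ⊗[kk] U l) (uE a) from rfl, serre_hom,
        (isRep_U l).serre_E i j hij, map_zero]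
    · rw [serre_map uE _ (TensorProduct.mk kk (U l) (U l) (uK (serreDeg i j • α i + α j))),
        (isRep_U l).serre_E i j hij, map_zero]
      intro m hm
      rw [Algebra.TensorProduct.tmul_pow, Algebra.TensorProduct.tmul_pow,
        Algebra.TensorProduct.tmul_mul_tmul, Algebra.TensorProduct.tmul_mul_tmul,
        serre_word_comm uK (isRep_U l).K_add (isRep_U l).K_zero i j m hm]
      rfl
    · intro a b
      rw [Algebra.TensorProduct.tmul_mul_tmul, Algebra.TensorProduct.tmul_mul_tmul,
        (isRep_U l).K_E, one_mul, mul_one, TensorProduct.smul_tmul']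
  serre_F i j hij := by
    rw [show (fun a : Fin l => uF a ⊗ₜ[kk] uK (-α a) + (1 : U l) ⊗ₜ[kk] uF a) =
      fun a => (1 : U l) ⊗ₜ[kk] uF a + uF a ⊗ₜ[kk] uK (-α a) from funext fun a => add_comm _ _]
    refine serre_add hij _ _ ?_ ?_ ?_
    · rw [show (fun a => (1 : U l) ⊗ₜ[kk] uF a) = fun a =>
        (Algebra.TensorProduct.includeRight : U l →ₐ[kk] U l ⊗[kk] U l) (uF a) from rfl, serre_hom,
        (isRep_U l).serre_F i j hij, map_zero]
    · rw [serre_map uF _ ((TensorProduct.mk kk (U l) (U l)).flip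
        (uK (-(serreDeg i j • α i + α j)))), (isRep_U l).serre_F i j hij, map_zero]
      intro m hm
      rw [Algebra.TensorProduct.tmul_pow, Algebra.TensorProduct.tmul_pow,
        Algebra.TensorProduct.tmul_mul_tmul, Algebra.TensorProduct.tmul_mul_tmul,
        serre_word_comm (fun μ => uK (-μ))
          (fun μ ν => by rw [(isRep_U l).K_add, neg_add])
          (by rw [neg_zero, (isRep_U l).K_zero]) i j m hm]
      rfl
    · intro a b
      rw [Algebra.TensorProduct.tmul_mul_tmul, Algebra.TensorProduct.tmul_mul_tmul,
        (isRep_U l).K_F, one_mul, mul_one, TensorProduct.tmul_smul, form_neg_left, neg_neg]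

/-- The coproduct of `U`: `E_i ↦ E_i ⊗ 1 + K_{α_i} ⊗ E_i`, `F_i ↦ F_i ⊗ K_{α_i}⁻¹ + 1 ⊗ F_i`,
`K_μ ↦ K_μ ⊗ K_μ`. -/
def comulU (l : ℕ) : U l →ₐ[kk] U l ⊗[kk] U l := liftU (isRep_comul l)

lemma isRep_antipode (l : ℕ) : IsRep (A := (U l)ᵐᵒᵖ)
    (fun i => MulOpposite.op (-(uK (-α i) * uE i))) (fun i => MulOpposite.op (-(uF i * uK (α i))))
    (fun μ => MulOpposite.op (uK (-μ))) where
  K_zero := by rw [neg_zero, (isRep_U l).K_zero]; rfl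
  K_add μ ν := by rw [← MulOpposite.op_mul, (isRep_U l).K_add, neg_add, add_comm]
  K_E μ j := by
    rw [← MulOpposite.op_mul, ← MulOpposite.op_mul, ← MulOpposite.op_smul, neg_mul, mul_neg,
      mul_assoc, uE_mul_uK, ← mul_assoc (uK (-μ)), uK_comm (-μ), mul_smul_comm, smul_neg,
      form_neg_left, neg_neg, mul_assoc]
  K_F μ j := by
    rw [← MulOpposite.op_mul, ← MulOpposite.op_mul, ← MulOpposite.op_smul, neg_mul, mul_neg,
      ← mul_assoc (uK (-μ)), (isRep_U l).K_F, mul_assoc, uK_comm (α j), smul_mul_assoc, smul_neg,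
      form_neg_left, neg_neg, smul_smul, ← zpow_add₀ q_ne_zero, neg_add_cancel, zpow_zero, one_smul,
      mul_assoc]
  E_F i j := by
    have h1 := (isRep_U l).E_F i j
    have h2 : uF j * uK (α j) * (uK (-α i) * uE i) =
        q ^ (form (α j) (α i) - form (α i) (α i)) • (uF j * uE i * (uK (α j) * uK (-α i))) := by
      rw [mul_assoc, ← mul_assoc (uK (α j)), (isRep_U l).K_add, (isRep_U l).K_E, mul_smul_comm,
        mul_assoc, form_add_left, form_neg_left, sub_eq_add_neg]
    have h3 : uK (-α i) * uE i * (uF j * uK (α j)) =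
        q ^ (form (α j) (α i) - form (α i) (α i)) • (uE i * uF j * (uK (α j) * uK (-α i))) := by
      rw [(isRep_U l).K_E, smul_mul_assoc, mul_assoc, ← mul_assoc (uK (-α i)), (isRep_U l).K_F,
        smul_mul_assoc, mul_smul_comm, smul_smul, ← zpow_add₀ q_ne_zero, mul_assoc (uF j),
        uK_comm (-α i), ← mul_assoc (uE i), form_neg_left, form_neg_left, form_comm (α i) (α j),
        neg_neg, sub_eq_add_neg, add_comm]
    apply MulOpposite.unop_injective
    rw [← MulOpposite.op_mul, ← MulOpposite.op_mul, MulOpposite.unop_sub, MulOpposite.unop_op,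
      MulOpposite.unop_op, neg_mul_neg, neg_mul_neg, h2, h3, ← smul_sub, ← sub_mul,
      ← neg_sub (uE i * uF j), h1]
    split_ifs with h
    · subst h
      rw [sub_self, zpow_zero, one_smul, K_mul_inv, mul_one, MulOpposite.unop_smul,
        MulOpposite.unop_sub, MulOpposite.unop_op, MulOpposite.unop_op, neg_neg, ← smul_neg, neg_sub]
    · rw [neg_zero, zero_mul, smul_zero, MulOpposite.unop_zero]
  serre_E i j hij := by
    have h := serre_twist hij uE (fun a => uK (-α a)) (fun a b => uK_comm _ _)
      (fun a b => by rw [uE_mul_uK, form_neg_left, neg_neg, form_comm])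
      ((isRep_U l).serre_E i j hij)
    have h' := serre_scale _ (fun _ => -1) h
    simp only [neg_smul, one_smul] at h'
    exact serre_op hij _ h'
  serre_F i j hij := by
    have h := serre_twist hij uF (fun a => uK (α a)) (fun a b => uK_comm _ _)
      (fun a b => by rw [uF_mul_uK, form_comm])
      ((isRep_U l).serre_F i j hij)
    have h' := serre_scale _ (fun a => -q ^ form (α a) (α a)) h
    simp only [neg_smul, ← uF_mul_uK] at h'
    exact serre_op hij _ h'

/-- The antipode of `U`, as a morphism to the opposite algebra: `E_i ↦ - K_{α_i}⁻¹ E_i`,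
`F_i ↦ - F_i K_{α_i}`, `K_μ ↦ K_μ⁻¹`. -/
def antipodeU (l : ℕ) : U l →ₐ[kk] (U l)ᵐᵒᵖ := liftU (isRep_antipode l)

/-! ### The algebra `Ũ = U ⋊ kΓ` -/

/-- The multiplicative group `Γ = {ξ_μ} ≃ P / 2P`. -/
abbrev Γ (l : ℕ) : Type := Multiplicative (Q l)

/-- The sign `(-1) ^ a`, for `a` in `ℤ / 2ℤ`. -/
def sgn (a : ZMod 2) : kk := if a = 0 then 1 else -1

@[simp] lemma sgn_zero : sgn 0 = 1 := if_pos rfl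

lemma sgn_one : sgn 1 = -1 := if_neg one_ne_zero

lemma sgn_add (a b : ZMod 2) : sgn (a + b) = sgn a * sgn b := by
  have h : ∀ c : ZMod 2, c = 0 ∨ c = 1 := by decide
  rcases h a with rfl | rfl <;> rcases h b with rfl | rfl
  · simp
  · simp
  · simp
  · rw [CharTwo.add_self_eq_zero, sgn_zero, sgn_one]; norm_num

lemma sgn_mul_self (a : ZMod 2) : sgn a * sgn a = 1 := by
  rw [← sgn_add, CharTwo.add_self_eq_zero, sgn_zero]

lemma isRep_act (θ : Q l) : IsRep (A := U l) (fun i => sgn (formQ θ (red l (α i))) • uE i)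
    (fun i => sgn (formQ θ (red l (α i))) • uF i) uK where
  K_zero := (isRep_U l).K_zero
  K_add := (isRep_U l).K_add
  K_E μ j := by rw [mul_smul_comm, smul_mul_assoc, (isRep_U l).K_E, smul_comm]
  K_F μ j := by rw [mul_smul_comm, smul_mul_assoc, (isRep_U l).K_F, smul_comm]
  E_F i j := by
    rw [smul_mul_smul_comm, smul_mul_smul_comm, mul_comm (sgn (formQ θ (red l (α j)))), ← smul_sub,
      (isRep_U l).E_F]
    split_ifs with h
    · rw [h, sgn_mul_self, one_smul]
    · rw [smul_zero]
  serre_E i j h := serre_scale _ _ ((isRep_U l).serre_E i j h)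
  serre_F i j h := serre_scale _ _ ((isRep_U l).serre_F i j h)

/-- The action of `ξ_θ` on `U`, by `(-1) ^ (θ, ν)` on the elements of weight `ν`: the generators `E_i`,
`F_i`, `K_μ` have weight `α_i`, `-α_i`, `0`. -/
def act (θ : Q l) : U l →ₐ[kk] U l := liftU (isRep_act θ)

lemma act_E (θ : Q l) (i : Fin l) : act θ (uE i) = sgn (formQ θ (red l (α i))) • uE i := liftU_E _ i
lemma act_F (θ : Q l) (i : Fin l) : act θ (uF i) = sgn (formQ θ (red l (α i))) • uF i := liftU_F _ i
lemma act_K (θ : Q l) (μ : P l) : act θ (uK μ) = uK μ := liftU_K _ μ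

lemma act_zero (u : U l) : act 0 u = u := by
  have h : act (0 : Q l) = AlgHom.id kk (U l) := by
    apply U_hom_ext <;> intro i <;> simp [act_E, act_F, act_K, formQ_zero_left]
  rw [h, AlgHom.id_apply]

lemma act_add (θ θ' : Q l) (u : U l) : act (θ + θ') u = act θ (act θ' u) := by
  have h : act (θ + θ') = (act θ).comp (act θ') := by
    apply U_hom_ext <;> intro i
    · rw [AlgHom.comp_apply, act_E, act_E, map_smul, act_E, smul_smul, formQ_add_left, sgn_add,
        mul_comm]
    · rw [AlgHom.comp_apply, act_F, act_F, map_smul, act_F, smul_smul, formQ_add_left, sgn_add,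
        mul_comm]
    · rw [AlgHom.comp_apply, act_K, act_K, act_K]
  rw [h, AlgHom.comp_apply]

instance : MulSemiringAction (Γ l) (U l) where
  smul g u := act g.toAdd u
  one_smul u := act_zero u
  mul_smul g h u := act_add g.toAdd h.toAdd u
  smul_zero g := map_zero (act g.toAdd)
  smul_add g := map_add (act g.toAdd)
  smul_one g := map_one (act g.toAdd)
  smul_mul g := map_mul (act g.toAdd)

lemma smul_def (g : Γ l) (u : U l) : g • u = act g.toAdd u := rfl

instance : SMulCommClass (Γ l) kk (U l) where
  smul_comm g c u := map_smul (act g.toAdd) c u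

/-- The algebra `Ũ = U ⋊ kΓ`: as a vector space it is `U ⊗ kΓ`, and
`(u ξ) (v ξ') = u (ξ • v) ξ ξ'`. -/
abbrev Ut (l : ℕ) : Type := SkewMonoidAlgebra (U l) (Γ l)

/-- The inclusion `U → Ũ`. -/
def incl (l : ℕ) : U l →ₐ[kk] Ut l where
  __ := SkewMonoidAlgebra.singleOneRingHom
  commutes' _ := rfl

lemma incl_apply (u : U l) : incl l u = SkewMonoidAlgebra.single 1 u := rfl

/-- The elements `ξ_θ` of `Ũ`. -/
def xi (θ : Q l) : Ut l := SkewMonoidAlgebra.single (Multiplicative.ofAdd θ) 1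

lemma xi_add (θ θ' : Q l) : xi (θ + θ') = xi θ * xi θ' := by
  rw [xi, xi, xi, SkewMonoidAlgebra.single_mul_single, smul_one, mul_one, ofAdd_add]

lemma xi_zero : xi (0 : Q l) = 1 := rfl

lemma Q_add_self (θ : Q l) : θ + θ = 0 := funext fun i => CharTwo.add_self_eq_zero (θ i)

lemma xi_mul_self (θ : Q l) : xi θ * xi θ = 1 := by
  rw [← xi_add, Q_add_self, xi_zero]

lemma xi_mul_incl (θ : Q l) (u : U l) : xi θ * incl l u = incl l (act θ u) * xi θ := by
  rw [xi, incl_apply, incl_apply, SkewMonoidAlgebra.single_mul_single,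
    SkewMonoidAlgebra.single_mul_single, one_mul, mul_one, one_mul, one_smul, mul_one]
  rfl

lemma single_eq (θ : Q l) (u : U l) :
    SkewMonoidAlgebra.single (Multiplicative.ofAdd θ) u = incl l u * xi θ := by
  rw [xi, incl_apply, SkewMonoidAlgebra.single_mul_single, one_mul, one_smul, mul_one]

/-- The element `E_i` of `Ũ`. -/
def tE (i : Fin l) : Ut l := incl l (uE i)
/-- The element `F_i` of `Ũ`. -/
def tF (i : Fin l) : Ut l := incl l (uF i)
/-- The element `K_μ` of `Ũ`. -/
def tK (μ : P l) : Ut l := incl l (uK μ)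

lemma IsRep.map {A B : Type*} [Ring A] [Algebra kk A] [Ring B] [Algebra kk B] {E F : Fin l → A}
    {K : P l → A} (h : IsRep E F K) (f : A →ₐ[kk] B) :
    IsRep (fun i => f (E i)) (fun i => f (F i)) (fun μ => f (K μ)) where
  K_zero := by rw [h.K_zero, map_one]
  K_add μ ν := by rw [← map_mul, h.K_add]
  K_E μ j := by rw [← map_mul, h.K_E, map_smul, map_mul]
  K_F μ j := by rw [← map_mul, h.K_F, map_smul, map_mul]
  E_F i j := by
    rw [← map_mul, ← map_mul, ← map_sub, h.E_F, apply_ite f, map_smul, map_sub, map_zero]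
  serre_E i j hij := by rw [serre_hom, h.serre_E i j hij, map_zero]
  serre_F i j hij := by rw [serre_hom, h.serre_F i j hij, map_zero]

lemma isRep_Ut (l : ℕ) : IsRep (tE (l := l)) tF tK := (isRep_U l).map (incl l)

lemma xi_mul_tE (θ : Q l) (i : Fin l) :
    xi θ * tE i = sgn (formQ θ (red l (α i))) • (tE i * xi θ) := by
  rw [tE, xi_mul_incl, act_E, map_smul, smul_mul_assoc]

lemma xi_mul_tF (θ : Q l) (i : Fin l) :
    xi θ * tF i = sgn (formQ θ (red l (α i))) • (tF i * xi θ) := by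
  rw [tF, xi_mul_incl, act_F, map_smul, smul_mul_assoc]

lemma xi_mul_tK (θ : Q l) (μ : P l) : xi θ * tK μ = tK μ * xi θ := by
  rw [tK, xi_mul_incl, act_K]

lemma Ut_induction {p : Ut l → Prop} (hE : ∀ i, p (tE i)) (hF : ∀ i, p (tF i)) (hK : ∀ μ, p (tK μ))
    (hξ : ∀ θ, p (xi θ)) (hc : ∀ c : kk, p (algebraMap kk (Ut l) c))
    (hadd : ∀ a b, p a → p b → p (a + b)) (hmul : ∀ a b, p a → p b → p (a * b)) (x : Ut l) :
    p x := by
  have hu : ∀ u : U l, p (incl l u) := by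
    intro u
    induction u using U_induction with
    | hE i => exact hE i
    | hF i => exact hF i
    | hK μ => exact hK μ
    | hc c => rw [AlgHom.commutes]; exact hc c
    | hadd a b ha hb => rw [map_add]; exact hadd _ _ ha hb
    | hmul a b ha hb => rw [map_mul]; exact hmul _ _ ha hb
  induction x using SkewMonoidAlgebra.induction_on with
  | zero => simpa using hc 0
  | single g u =>
    have := single_eq g.toAdd u
    rw [ofAdd_toAdd] at this
    rw [this]
    exact hmul _ _ (hu u) (hξ _)
  | add a b ha hb => exact hadd _ _ ha hb

section LiftUt

variable {A : Type*} [Ring A] [Algebra kk A]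

/-- It is enough to check the relations `g ξ * f u = f (ξ • u) * g ξ` on the generators `u` of `U`. -/
lemma comm_of_gen (f : U l →ₐ[kk] A) (g : Γ l →* A)
    (hE : ∀ x i, f (x • uE i) * g x = g x * f (uE i))
    (hF : ∀ x i, f (x • uF i) * g x = g x * f (uF i))
    (hK : ∀ x μ, f (x • uK μ) * g x = g x * f (uK μ)) (u : U l) (x : Γ l) :
    f (x • u) * g x = g x * f u := by
  induction u using U_induction with
  | hE i => exact hE x i
  | hF i => exact hF x i
  | hK μ => exact hK x μ
  | hc c => rw [smul_algebraMap, AlgHom.commutes, Algebra.commutes]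
  | hadd a b ha hb => rw [smul_add, map_add, map_add, add_mul, mul_add, ha, hb]
  | hmul a b ha hb => rw [smul_mul', map_mul, map_mul, mul_assoc, hb, ← mul_assoc, ha, mul_assoc]

/-- The morphism `Ũ → A` given by compatible morphisms `f : U → A` and `g : Γ → A`. -/
def liftUt (f : U l →ₐ[kk] A) (g : Γ l →* A) (h : ∀ u x, f (x • u) * g x = g x * f u) :
    Ut l →ₐ[kk] A :=
  SkewMonoidAlgebra.liftNCAlgHom f g (fun {u x} => h u x)

lemma liftUt_single (f : U l →ₐ[kk] A) (g : Γ l →* A) (h : ∀ u x, f (x • u) * g x = g x * f u)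
    (x : Γ l) (u : U l) : liftUt f g h (SkewMonoidAlgebra.single x u) = f u * g x :=
  SkewMonoidAlgebra.liftNC_single _ _ _ _

lemma liftUt_incl (f : U l →ₐ[kk] A) (g : Γ l →* A) (h : ∀ u x, f (x • u) * g x = g x * f u)
    (u : U l) : liftUt f g h (incl l u) = f u := by
  rw [incl_apply, liftUt_single, map_one, mul_one]

lemma liftUt_xi (f : U l →ₐ[kk] A) (g : Γ l →* A) (h : ∀ u x, f (x • u) * g x = g x * f u)
    (θ : Q l) : liftUt f g h (xi θ) = g (Multiplicative.ofAdd θ) := by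
  rw [xi, liftUt_single, map_one, one_mul]

end LiftUt

/-! ### The Hopf structure of `Ũ` -/

/-- The group morphism `Γ → A` attached to a map `e` with `e 0 = 1`, `e (θ + θ') = e θ * e θ'`. -/
def homΓ {A : Type*} [Monoid A] (e : Q l → A) (h0 : e 0 = 1)
    (hadd : ∀ θ θ', e (θ + θ') = e θ * e θ') : Γ l →* A where
  toFun g := e g.toAdd
  map_one' := h0
  map_mul' g h := hadd g.toAdd h.toAdd

/-- The counit `ε` of `Ũ`: `u ξ ↦ ε u`. -/
def counit (l : ℕ) : Ut l →ₐ[kk] kk :=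
  liftUt (counitU l) (homΓ (fun _ => 1) rfl fun _ _ => (one_mul 1).symm)
    (comm_of_gen _ _
      (fun x i => by simp [smul_def, act_E, counitU, homΓ])
      (fun x i => by simp [smul_def, act_F, counitU, homΓ])
      (fun x μ => by simp [smul_def, act_K, counitU, homΓ]))

/-- The coproduct `Δ` of `Ũ`: `u ξ ↦ Δ u (ξ ⊗ ξ)`. -/
def comul (l : ℕ) : Ut l →ₐ[kk] Ut l ⊗[kk] Ut l :=
  liftUt ((Algebra.TensorProduct.map (incl l) (incl l)).comp (comulU l))
    (homΓ (fun θ => xi θ ⊗ₜ xi θ) rfl fun θ θ' => by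
      rw [Algebra.TensorProduct.tmul_mul_tmul, xi_add])
    (comm_of_gen _ _
      (fun x i => by
        change _ * xi x.toAdd ⊗ₜ xi x.toAdd = xi x.toAdd ⊗ₜ xi x.toAdd * _
        rw [smul_def, act_E, map_smul, AlgHom.comp_apply, comulU, liftU_E, map_add,
          Algebra.TensorProduct.map_tmul, Algebra.TensorProduct.map_tmul, map_one, mul_add,
          Algebra.TensorProduct.tmul_mul_tmul, Algebra.TensorProduct.tmul_mul_tmul,
          xi_mul_incl, xi_mul_incl, act_E, act_K, map_smul, smul_mul_assoc, smul_mul_assoc,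
          TensorProduct.tmul_smul, ← TensorProduct.smul_tmul', ← smul_add, add_mul,
          Algebra.TensorProduct.tmul_mul_tmul, Algebra.TensorProduct.tmul_mul_tmul, mul_one,
          one_mul])
      (fun x i => by
        change _ * xi x.toAdd ⊗ₜ xi x.toAdd = xi x.toAdd ⊗ₜ xi x.toAdd * _
        rw [smul_def, act_F, map_smul, AlgHom.comp_apply, comulU, liftU_F, map_add,
          Algebra.TensorProduct.map_tmul, Algebra.TensorProduct.map_tmul, map_one, mul_add,
          Algebra.TensorProduct.tmul_mul_tmul, Algebra.TensorProduct.tmul_mul_tmul,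
          xi_mul_incl, xi_mul_incl, act_F, act_K, map_smul, smul_mul_assoc, smul_mul_assoc,
          TensorProduct.tmul_smul, ← TensorProduct.smul_tmul', ← smul_add, add_mul,
          Algebra.TensorProduct.tmul_mul_tmul, Algebra.TensorProduct.tmul_mul_tmul, mul_one,
          one_mul])
      (fun x μ => by
        change _ * xi x.toAdd ⊗ₜ xi x.toAdd = xi x.toAdd ⊗ₜ xi x.toAdd * _
        rw [smul_def, act_K, AlgHom.comp_apply, comulU, liftU_K, Algebra.TensorProduct.map_tmul,
          Algebra.TensorProduct.tmul_mul_tmul, Algebra.TensorProduct.tmul_mul_tmul, xi_mul_incl,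
          act_K]))

lemma antipode_comm_aux (θ : Q l) (v : U l) (a : ZMod 2) (hv : act θ v = sgn a • v) :
    sgn a • MulOpposite.op (incl l v) * MulOpposite.op (xi θ) =
      MulOpposite.op (xi θ) * MulOpposite.op (incl l v) := by
  rw [smul_mul_assoc, ← MulOpposite.op_mul, ← MulOpposite.op_mul, xi_mul_incl, hv, map_smul,
    smul_mul_assoc, MulOpposite.op_smul, smul_smul, sgn_mul_self, one_smul]

/-- The antipode of `Ũ`, as a morphism to the opposite algebra. -/
def antipodeOp (l : ℕ) : Ut l →ₐ[kk] (Ut l)ᵐᵒᵖ :=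
  liftUt ((AlgHom.op (incl l)).comp (antipodeU l))
    (homΓ (fun θ => MulOpposite.op (xi θ)) rfl fun θ θ' => by
      rw [← MulOpposite.op_mul, ← xi_add, add_comm])
    (comm_of_gen _ _
      (fun x i => by
        rw [smul_def, act_E, map_smul, AlgHom.comp_apply, antipodeU, liftU_E]
        refine antipode_comm_aux x.toAdd _ _ ?_
        rw [MulOpposite.unop_op, map_neg, map_mul, act_K, act_E, mul_smul_comm, smul_neg])
      (fun x i => by
        rw [smul_def, act_F, map_smul, AlgHom.comp_apply, antipodeU, liftU_F]
        refine antipode_comm_aux x.toAdd _ _ ?_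
        rw [MulOpposite.unop_op, map_neg, map_mul, act_K, act_F, smul_mul_assoc, smul_neg])
      (fun x μ => by
        rw [smul_def, act_K, AlgHom.comp_apply, antipodeU, liftU_K]
        have := antipode_comm_aux x.toAdd (uK (-μ)) 0 (by rw [act_K, sgn_zero, one_smul])
        rwa [sgn_zero, one_smul] at this))

/-- The antipode `S` of `Ũ`, which is the antimorphism with `S (u ξ) = ξ S u`. -/
def antipode (l : ℕ) : Ut l →ₗ[kk] Ut l :=
  (MulOpposite.opLinearEquiv kk).symm.toLinearMap ∘ₗ (antipodeOp l).toLinearMap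

lemma antipode_mul (x y : Ut l) : antipode l (x * y) = antipode l y * antipode l x := by
  simp [antipode]

lemma comul_tE (i : Fin l) : comul l (tE i) = tE i ⊗ₜ 1 + tK (α i) ⊗ₜ tE i := by
  rw [tE, comul, liftUt_incl, AlgHom.comp_apply, comulU, liftU_E, map_add,
    Algebra.TensorProduct.map_tmul, Algebra.TensorProduct.map_tmul, map_one, tK]

lemma comul_tF (i : Fin l) : comul l (tF i) = tF i ⊗ₜ tK (-α i) + 1 ⊗ₜ tF i := by
  rw [tF, comul, liftUt_incl, AlgHom.comp_apply, comulU, liftU_F, map_add,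
    Algebra.TensorProduct.map_tmul, Algebra.TensorProduct.map_tmul, map_one, tK]

lemma comul_tK (μ : P l) : comul l (tK μ) = tK μ ⊗ₜ tK μ := by
  rw [tK, comul, liftUt_incl, AlgHom.comp_apply, comulU, liftU_K, Algebra.TensorProduct.map_tmul]

lemma comul_xi (θ : Q l) : comul l (xi θ) = xi θ ⊗ₜ xi θ := by
  rw [comul, liftUt_xi]; rfl

lemma antipode_tE (i : Fin l) : antipode l (tE i) = -(tK (-α i) * tE i) := by
  simp [tE, tK, antipode, antipodeOp, liftUt_incl, antipodeU]

lemma antipode_tF (i : Fin l) : antipode l (tF i) = -(tF i * tK (α i)) := by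
  simp [tF, tK, antipode, antipodeOp, liftUt_incl, antipodeU]

lemma antipode_tK (μ : P l) : antipode l (tK μ) = tK (-μ) := by
  simp [tK, antipode, antipodeOp, liftUt_incl, antipodeU]

lemma antipode_xi (θ : Q l) : antipode l (xi θ) = xi θ := by
  simp [antipode, antipodeOp, liftUt_xi]
  rfl

/-! ### Gradations of `Ũ` -/

/-- Degrees in an abelian group `M` for the generators of `Ũ`, with `0` for the `ξ_θ`, for which the
defining relations are homogeneous. -/
structure Deg (l : ℕ) (M : Type) [AddCommGroup M] where
  /-- the degree of `E_i` -/
  E : Fin l → M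
  /-- the degree of `F_i` -/
  F : Fin l → M
  /-- the degree of `K_μ` -/
  K : P l →+ M
  E_F : ∀ i, E i + F i = K (α i)
  E_F_neg : ∀ i, E i + F i = K (-α i)

section Gradation

variable {M : Type} [AddCommGroup M] (d : Deg l M)

lemma isRep_single : IsRep (A := AddMonoidAlgebra (Ut l) M)
    (fun i => AddMonoidAlgebra.single (d.E i) (tE i))
    (fun i => AddMonoidAlgebra.single (d.F i) (tF i))
    (fun μ => AddMonoidAlgebra.single (d.K μ) (tK μ)) where
  K_zero := by rw [map_zero, (isRep_Ut l).K_zero]; rfl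
  K_add μ ν := by rw [AddMonoidAlgebra.single_mul_single, (isRep_Ut l).K_add, map_add]
  K_E μ j := by
    rw [AddMonoidAlgebra.single_mul_single, AddMonoidAlgebra.single_mul_single, (isRep_Ut l).K_E,
      AddMonoidAlgebra.smul_single, add_comm]
  K_F μ j := by
    rw [AddMonoidAlgebra.single_mul_single, AddMonoidAlgebra.single_mul_single, (isRep_Ut l).K_F,
      AddMonoidAlgebra.smul_single, add_comm]
  E_F i j := by
    rw [AddMonoidAlgebra.single_mul_single, AddMonoidAlgebra.single_mul_single,
      add_comm (d.F j), ← AddMonoidAlgebra.single_sub, (isRep_Ut l).E_F]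
    split_ifs with h
    · subst h
      rw [← d.E_F, ← d.E_F_neg, ← AddMonoidAlgebra.single_sub, AddMonoidAlgebra.smul_single]
    · rw [AddMonoidAlgebra.single_zero]
  serre_E i j hij := by
    rw [serre_map tE _ (AddMonoidAlgebra.lsingle (R := kk) (serreDeg i j • d.E i + d.E j)),
      (isRep_Ut l).serre_E i j hij, map_zero]
    intro m hm
    rw [AddMonoidAlgebra.single_pow, AddMonoidAlgebra.single_pow,
      AddMonoidAlgebra.single_mul_single, AddMonoidAlgebra.single_mul_single,
      AddMonoidAlgebra.lsingle_apply]
    congr 1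
    obtain ⟨e, he⟩ := Nat.exists_eq_add_of_le hm
    rw [he, Nat.add_sub_cancel_left, add_nsmul]
    abel
  serre_F i j hij := by
    rw [serre_map tF _ (AddMonoidAlgebra.lsingle (R := kk) (serreDeg i j • d.F i + d.F j)),
      (isRep_Ut l).serre_F i j hij, map_zero]
    intro m hm
    rw [AddMonoidAlgebra.single_pow, AddMonoidAlgebra.single_pow,
      AddMonoidAlgebra.single_mul_single, AddMonoidAlgebra.single_mul_single,
      AddMonoidAlgebra.lsingle_apply]
    congr 1
    obtain ⟨e, he⟩ := Nat.exists_eq_add_of_le hm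
    rw [he, Nat.add_sub_cancel_left, add_nsmul]
    abel

/-- The algebra morphism `Ũ → Ũ[M]` which maps each generator `x` of degree `m` to `x` placed in
degree `m`. -/
def gradHom : Ut l →ₐ[kk] AddMonoidAlgebra (Ut l) M :=
  liftUt (liftU (isRep_single d))
    (homΓ (fun θ => AddMonoidAlgebra.single 0 (xi θ)) rfl fun θ θ' => by
      rw [AddMonoidAlgebra.single_mul_single, zero_add, xi_add])
    (comm_of_gen _ _
      (fun x i => by
        change _ * AddMonoidAlgebra.single 0 (xi x.toAdd) =
          AddMonoidAlgebra.single 0 (xi x.toAdd) * _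
        rw [smul_def, act_E, map_smul, liftU_E, smul_mul_assoc,
          AddMonoidAlgebra.single_mul_single, AddMonoidAlgebra.single_mul_single, xi_mul_tE,
          AddMonoidAlgebra.smul_single, zero_add, add_zero])
      (fun x i => by
        change _ * AddMonoidAlgebra.single 0 (xi x.toAdd) =
          AddMonoidAlgebra.single 0 (xi x.toAdd) * _
        rw [smul_def, act_F, map_smul, liftU_F, smul_mul_assoc,
          AddMonoidAlgebra.single_mul_single, AddMonoidAlgebra.single_mul_single, xi_mul_tF,
          AddMonoidAlgebra.smul_single, zero_add, add_zero])
      (fun x μ => by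
        change _ * AddMonoidAlgebra.single 0 (xi x.toAdd) =
          AddMonoidAlgebra.single 0 (xi x.toAdd) * _
        rw [smul_def, act_K, liftU_K, AddMonoidAlgebra.single_mul_single,
          AddMonoidAlgebra.single_mul_single, xi_mul_tK, zero_add, add_zero]))

/-- The homogeneous component of degree `m` of the gradation of `Ũ` for which the generators have
the degrees prescribed by `d` (and `ξ_θ` has degree `0`). -/
def piece (m : M) : Submodule kk (Ut l) where
  carrier := {x | gradHom d x = AddMonoidAlgebra.single m x}
  zero_mem' := by simp
  add_mem' {a b} ha hb := by
    change gradHom d (a + b) = _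
    rw [map_add, AddMonoidAlgebra.single_add]
    exact congrArg₂ _ ha hb
  smul_mem' c a ha := by
    change gradHom d (c • a) = _
    rw [map_smul, ← AddMonoidAlgebra.smul_single]
    exact congrArg _ ha

lemma mem_piece {m : M} {x : Ut l} : x ∈ piece d m ↔ gradHom d x = AddMonoidAlgebra.single m x :=
  Iff.rfl

lemma tE_mem_piece (i : Fin l) : tE i ∈ piece d (d.E i) := by
  rw [mem_piece, gradHom, tE, liftUt_incl, liftU_E]; rfl

lemma tF_mem_piece (i : Fin l) : tF i ∈ piece d (d.F i) := by
  rw [mem_piece, gradHom, tF, liftUt_incl, liftU_F]; rfl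

lemma tK_mem_piece (μ : P l) : tK μ ∈ piece d (d.K μ) := by
  rw [mem_piece, gradHom, tK, liftUt_incl, liftU_K]; rfl

lemma xi_mem_piece (θ : Q l) : xi θ ∈ piece d 0 := by
  rw [mem_piece, gradHom, liftUt_xi]; rfl

instance : SetLike.GradedMonoid (piece d) where
  one_mem := by rw [mem_piece, map_one]; rfl
  mul_mem m n a b ha hb := by
    rw [mem_piece] at *
    rw [map_mul, ha, hb, AddMonoidAlgebra.single_mul_single]

lemma mem_iSup_of_gen (W : M → Submodule kk (Ut l)) [SetLike.GradedMonoid W]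
    (hE : ∀ i, tE i ∈ W (d.E i)) (hF : ∀ i, tF i ∈ W (d.F i)) (hK : ∀ μ, tK μ ∈ W (d.K μ))
    (hξ : ∀ θ, xi θ ∈ W 0) (x : Ut l) : x ∈ ⨆ m, W m := by
  have hle : ∀ m, W m ≤ ⨆ m, W m := le_iSup W
  induction x using Ut_induction with
  | hE i => exact hle _ (hE i)
  | hF i => exact hle _ (hF i)
  | hK μ => exact hle _ (hK μ)
  | hξ θ => exact hle _ (hξ θ)
  | hc c =>
    rw [Algebra.algebraMap_eq_smul_one]
    exact Submodule.smul_mem _ _ (hle 0 (SetLike.GradedOne.one_mem))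
  | hadd a b ha hb => exact Submodule.add_mem _ ha hb
  | hmul a b ha hb =>
    refine Submodule.iSup_induction W (motive := fun a => a * b ∈ ⨆ m, W m) ha ?_ (by simp)
      (fun y z hy hz => by rw [add_mul]; exact Submodule.add_mem _ hy hz)
    intro m y hy
    refine Submodule.iSup_induction W (motive := fun b => y * b ∈ ⨆ m, W m) hb ?_ (by simp)
      (fun u v hu hv => by rw [mul_add]; exact Submodule.add_mem _ hu hv)
    intro n z hz
    exact hle _ (SetLike.GradedMul.mul_mem hy hz)

/-- The components of `x` for the gradation lie in any graded subspace which contains the generators. -/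
lemma coeff_mem (W : M → Submodule kk (Ut l)) [SetLike.GradedMonoid W]
    (hE : ∀ i, tE i ∈ W (d.E i)) (hF : ∀ i, tF i ∈ W (d.F i)) (hK : ∀ μ, tK μ ∈ W (d.K μ))
    (hξ : ∀ θ, xi θ ∈ W 0) (x : Ut l) (m : M) : (gradHom d x).coeff m ∈ W m ⊓ piece d m := by
  classical
  have : SetLike.GradedMonoid (fun m => W m ⊓ piece d m) :=
    { one_mem := ⟨SetLike.GradedOne.one_mem, SetLike.GradedOne.one_mem⟩
      mul_mem := fun m n a b ha hb =>
        ⟨SetLike.GradedMul.mul_mem ha.1 hb.1, SetLike.GradedMul.mul_mem ha.2 hb.2⟩ }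
  have hx := mem_iSup_of_gen d (fun m => W m ⊓ piece d m) (fun i => ⟨hE i, tE_mem_piece d i⟩)
    (fun i => ⟨hF i, tF_mem_piece d i⟩) (fun i => ⟨hK i, tK_mem_piece d i⟩)
    (fun i => ⟨hξ i, xi_mem_piece d i⟩) x
  refine Submodule.iSup_induction _ (motive := fun x => (gradHom d x).coeff m ∈ W m ⊓ piece d m) hx
    ?_ (by simp) (fun y z hy hz => ?_)
  · intro n y hy
    rw [hy.2, AddMonoidAlgebra.coeff_single, Finsupp.single_apply]
    split_ifs with h
    · rw [← h]; exact hy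
    · exact Submodule.zero_mem _
  · rw [map_add, AddMonoidAlgebra.coeff_add, Finsupp.add_apply]
    exact Submodule.add_mem _ hy hz

lemma coeff_mem_piece (x : Ut l) (m : M) : (gradHom d x).coeff m ∈ piece d m :=
  (coeff_mem d (piece d) (tE_mem_piece d) (tF_mem_piece d) (tK_mem_piece d) (xi_mem_piece d) x m).2

lemma sum_coeff (x : Ut l) : (gradHom d x).coeff.sum (fun _ a => a) = x := by
  classical
  have hx := mem_iSup_of_gen d (piece d) (tE_mem_piece d) (tF_mem_piece d) (tK_mem_piece d)
    (xi_mem_piece d) x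
  refine Submodule.iSup_induction _
    (motive := fun x => (gradHom d x).coeff.sum (fun _ a => a) = x) hx
    ?_ (by simp) (fun y z hy hz => ?_)
  · intro n y hy
    rw [hy, AddMonoidAlgebra.coeff_single, Finsupp.sum_single_index rfl]
  · rw [map_add, AddMonoidAlgebra.coeff_add, Finsupp.sum_add_index' (fun _ => rfl)
      (fun _ _ _ => rfl), hy, hz]

/-- The family of the homogeneous components of `x`. -/
def components [DecidableEq M] (x : Ut l) : ⨁ m, piece d m :=
  DirectSum.mk (fun m => piece d m) (gradHom d x).coeff.support
    (fun m => ⟨(gradHom d x).coeff m, coeff_mem_piece d x m⟩)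

lemma components_apply [DecidableEq M] (x : Ut l) (m : M) :
    (components d x m : Ut l) = (gradHom d x).coeff m := by
  by_cases h : m ∈ (gradHom d x).coeff.support
  · rw [components, DirectSum.mk_apply_of_mem h]
  · rw [components, DirectSum.mk_apply_of_notMem h, Finsupp.notMem_support_iff.1 h]
    rfl

/-- The gradation attached to `d` is an algebra gradation. -/
instance gradedAlgebra_piece [DecidableEq M] : GradedAlgebra (piece d) where
  decompose' x := components d x
  left_inv x := by
    classical
    conv_rhs => rw [← sum_coeff d x]
    rw [DirectSum.coeAddMonoidHom_eq_dfinsuppSum, DFinsupp.sum, Finsupp.sum]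
    refine Finset.sum_congr_of_eq_on_inter ?_ ?_ ?_
    · intro m _ hm
      rw [components_apply]
      exact Finsupp.notMem_support_iff.1 hm
    · intro m _ hm
      have := components_apply d x m
      rw [DFinsupp.notMem_support_iff.1 hm] at this
      exact this.symm
    · intro m _ _
      exact components_apply d x m
  right_inv y := by
    refine DFinsupp.ext fun m => Subtype.ext ?_
    rw [components_apply]
    induction y using DirectSum.induction_on with
    | zero => simp
    | of n y =>
      rw [DirectSum.coeAddMonoidHom_of, (mem_piece d).1 y.2, AddMonoidAlgebra.coeff_single,
        Finsupp.single_apply, DirectSum.coe_of_apply]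
      split_ifs <;> rfl
    | add a b ha hb =>
      rw [map_add, map_add, AddMonoidAlgebra.coeff_add, Finsupp.add_apply, ha, hb,
        DirectSum.add_apply, Submodule.coe_add]

lemma decompose_piece [DecidableEq M] (x : Ut l) (m : M) :
    (DirectSum.decompose (piece d) x m : Ut l) = (gradHom d x).coeff m :=
  components_apply d x m

end Gradation

lemma red_βsucc_add (i : Fin l) : red l (βsucc i) + red l (β i) = red l (α i) := by
  have h : red l (β i) = red l (α i) + red l (βsucc i) := by rw [← map_add, α, sub_add_cancel]
  rw [h, add_left_comm, Q_add_self, add_zero]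

lemma red_neg (v : P l) : red l (-v) = red l v := by
  have := Q_add_self (red l v)
  rw [map_neg, neg_eq_of_add_eq_zero_left this]

/-- The degrees for the weights. -/
def degWeight (l : ℕ) : Deg l (P l) where
  E i := α i
  F i := -α i
  K := 0
  E_F _ := add_neg_cancel _
  E_F_neg _ := add_neg_cancel _

/-- The degrees of the `μ`-gradation. -/
def degMu (l : ℕ) : Deg l (Q l) where
  E i := red l (βsucc i)
  F i := red l (β i)
  K := red l
  E_F i := red_βsucc_add i
  E_F_neg i := by rw [red_neg]; exact red_βsucc_add i

/-- The degrees of the `δ`-gradation. -/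
def degDelta (l : ℕ) : Deg l (Q l) where
  E _ := 0
  F i := red l (α i)
  K := red l
  E_F _ := zero_add _
  E_F_neg _ := by rw [red_neg, zero_add]

/-- The subspace of `Ũ` of the elements of weight `ν`: those `x` for which
`K_μ x K_μ⁻¹ = q ^ (ν, μ) x` for all `μ`. -/
def weightSpace (ν : P l) : Submodule kk (Ut l) where
  carrier := {x | ∀ μ : P l, tK μ * x * tK (-μ) = q ^ form ν μ • x}
  zero_mem' := by intro μ; simp
  add_mem' {a b} ha hb μ := by rw [mul_add, add_mul, ha μ, hb μ, smul_add]
  smul_mem' c a ha μ := by rw [mul_smul_comm, smul_mul_assoc, ha μ, smul_comm]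

lemma mem_weightSpace {ν : P l} {x : Ut l} :
    x ∈ weightSpace ν ↔ ∀ μ : P l, tK μ * x * tK (-μ) = q ^ form ν μ • x := Iff.rfl

lemma tK_inv_mul (μ : P l) : tK (-μ) * tK μ = 1 := by
  rw [(isRep_Ut l).K_add, neg_add_cancel, (isRep_Ut l).K_zero]

lemma tK_mul_inv (μ : P l) : tK μ * tK (-μ) = 1 := by
  rw [(isRep_Ut l).K_add, add_neg_cancel, (isRep_Ut l).K_zero]

instance : SetLike.GradedMonoid (weightSpace (l := l)) where
  one_mem μ := by rw [mul_one, tK_mul_inv, form_zero_left, zpow_zero, one_smul]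
  mul_mem m n a b ha hb μ := by
    calc tK μ * (a * b) * tK (-μ) = tK μ * a * (tK (-μ) * tK μ) * b * tK (-μ) := by
          rw [tK_inv_mul]; noncomm_ring
      _ = (tK μ * a * tK (-μ)) * (tK μ * b * tK (-μ)) := by noncomm_ring
      _ = q ^ form (m + n) μ • (a * b) := by
          rw [ha μ, hb μ, smul_mul_smul_comm, ← zpow_add₀ q_ne_zero, form_add_left]

lemma tE_mem_weightSpace (i : Fin l) : tE i ∈ weightSpace (α i) := fun μ => by
  rw [(isRep_Ut l).K_E, smul_mul_assoc, mul_assoc, tK_mul_inv, mul_one, form_comm]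

lemma tF_mem_weightSpace (i : Fin l) : tF i ∈ weightSpace (-α i) := fun μ => by
  rw [(isRep_Ut l).K_F, smul_mul_assoc, mul_assoc, tK_mul_inv, mul_one, form_comm, form_neg_left]

lemma tK_mem_weightSpace (ν : P l) : tK ν ∈ weightSpace 0 := fun μ => by
  rw [(isRep_Ut l).K_add, (isRep_Ut l).K_add, form_zero_left, zpow_zero, one_smul]
  congr 1
  abel

lemma xi_mem_weightSpace (θ : Q l) : xi θ ∈ weightSpace 0 := fun μ => by
  rw [← xi_mul_tK, mul_assoc, tK_mul_inv, form_zero_left, zpow_zero, one_smul, mul_one]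

/-- The weight spaces are the components of the gradation for which `E_i`, `F_i`, `K_μ`, `ξ_θ` have
degrees `α_i`, `-α_i`, `0`, `0`. -/
lemma weightSpace_eq : weightSpace (l := l) = piece (degWeight l) := by
  have hc := coeff_mem (degWeight l) weightSpace tE_mem_weightSpace tF_mem_weightSpace
    tK_mem_weightSpace xi_mem_weightSpace
  ext ν x
  constructor
  · intro hx
    have h0 : ∀ m, m ≠ ν → (gradHom (degWeight l) x).coeff m = 0 := by
      intro m hm
      obtain ⟨i, hi⟩ : ∃ i, m i ≠ ν i := by
        by_contra h
        push Not at h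
        exact hm (funext h)
      have h1 := congrArg (fun y => (gradHom (degWeight l) y).coeff m) (hx (β i))
      have hK : ∀ μ, gradHom (degWeight l) (tK μ) = AddMonoidAlgebra.single 0 (tK μ) :=
        tK_mem_piece (degWeight l)
      simp only [map_mul, map_smul, hK, AddMonoidAlgebra.coeff_mul_single_zero,
        AddMonoidAlgebra.coeff_single_zero_mul, AddMonoidAlgebra.coeff_smul_apply] at h1
      rw [(hc x m).1 (β i), form_β, form_β, ← sub_eq_zero, ← sub_smul] at h1
      refine (smul_eq_zero.1 h1).resolve_left fun h => hi ?_
      exact q_zpow_injective (sub_eq_zero.1 h)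
    have h2 : gradHom (degWeight l) x =
        AddMonoidAlgebra.single ν ((gradHom (degWeight l) x).coeff ν) := by
      refine AddMonoidAlgebra.coeff_injective (Finsupp.ext fun m => ?_)
      rw [AddMonoidAlgebra.coeff_single, Finsupp.single_apply]
      split_ifs with h
      · rw [h]
      · exact h0 m (Ne.symm h)
    have h3 := sum_coeff (degWeight l) x
    rw [h2, AddMonoidAlgebra.coeff_single, Finsupp.sum_single_index rfl] at h3
    rw [mem_piece]
    conv_lhs => rw [h2, h3]
  · intro hx
    have := (hc x ν).1
    rwa [(mem_piece _).1 hx, AddMonoidAlgebra.coeff_single, Finsupp.single_eq_same] at this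

instance : GradedAlgebra (weightSpace (l := l)) := weightSpace_eq (l := l) ▸ inferInstance

/-- The component of degree `θ` of the `μ`-gradation of `Ũ`, for which `ξ_θ`, `K_μ`, `E_i`, `F_i` have
degrees `0`, `μ`, `β_{i+1}`, `β_i`. -/
abbrev muSpace (θ : Q l) : Submodule kk (Ut l) := piece (degMu l) θ

/-- The component of degree `θ` of the `δ`-gradation of `Ũ`, for which `ξ_θ`, `K_μ`, `E_i`, `F_i` have
degrees `0`, `μ`, `0`, `α_i`. -/
abbrev deltaSpace (θ : Q l) : Submodule kk (Ut l) := piece (degDelta l) θ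

/-- For `x` of weight `ν`, one has `ξ_θ x ξ_θ⁻¹ = (-1) ^ (θ, ν) x`. -/
lemma xi_mul_of_weight (θ : Q l) {ν : P l} {x : Ut l} (hx : x ∈ weightSpace ν) :
    xi θ * x = sgn (formQ θ (red l ν)) • (x * xi θ) := by
  let W : P l → Submodule kk (Ut l) := fun ν =>
    { carrier := {x | xi θ * x = sgn (formQ θ (red l ν)) • (x * xi θ)}
      zero_mem' := by simp
      add_mem' := fun {a b} (ha : _ = _) (hb : _ = _) => by
        change _ = _
        rw [mul_add, add_mul, ha, hb, smul_add]
      smul_mem' := fun c a (ha : _ = _) => by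
        change _ = _
        rw [mul_smul_comm, smul_mul_assoc, ha, smul_comm] }
  have : SetLike.GradedMonoid W :=
    { one_mem := by
        change _ = _
        rw [map_zero, formQ_zero_right, sgn_zero, one_smul, one_mul, mul_one]
      mul_mem := fun m n a b (ha : _ = _) (hb : _ = _) => by
        change _ = _
        rw [← mul_assoc, ha, smul_mul_assoc, mul_assoc, hb, mul_smul_comm, smul_smul, map_add,
          formQ_add_right, sgn_add, mul_assoc] }
  have hc := (coeff_mem (degWeight l) W (fun i => xi_mul_tE θ i)
    (fun i => by
      change _ = sgn (formQ θ (red l (-α i))) • _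
      rw [red_neg]
      exact xi_mul_tF θ i)
    (fun μ => by
      change _ = sgn (formQ θ (red l 0)) • _
      rw [map_zero, formQ_zero_right, sgn_zero, one_smul]
      exact xi_mul_tK θ μ)
    (fun θ' => by
      change _ = sgn (formQ θ (red l 0)) • _
      rw [map_zero, formQ_zero_right, sgn_zero, one_smul, ← xi_add, ← xi_add, add_comm]) x ν).1
  rw [weightSpace_eq] at hx
  rw [(mem_piece _).1 hx, AddMonoidAlgebra.coeff_single, Finsupp.single_eq_same] at hc
  exact hc

/-- If `u` in `U` has weight `ν` then `ξ_θ • u = (-1) ^ (θ, ν) u`. -/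
lemma act_of_weight (θ : Q l) {ν : P l} {u : U l} (hu : incl l u ∈ weightSpace ν) :
    act θ u = sgn (formQ θ (red l ν)) • u := by
  have h := xi_mul_of_weight θ hu
  rw [xi_mul_incl, ← smul_mul_assoc] at h
  have h' := congrArg (fun y => y * xi θ) h
  simp only [mul_assoc, xi_mul_self, mul_one] at h'
  rw [← map_smul] at h'
  exact SkewMonoidAlgebra.single_injective 1 h'

/-- `ξ = ξ_{w_l}`. -/
def xiLast (l : ℕ) : Ut l := xi (red l (wlast l))

lemma xiLast_mul_self (l : ℕ) : xiLast l * xiLast l = 1 := xi_mul_self _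

/-- The `ℤ / 2ℤ`-gradation of `Ũ`: `x` has degree `i` when `ξ x ξ = (-1) ^ i x`. -/
def parity (l : ℕ) (i : ZMod 2) : Submodule kk (Ut l) where
  carrier := {x | xiLast l * x * xiLast l = sgn i • x}
  zero_mem' := by simp
  add_mem' {a b} (ha : _ = _) (hb : _ = _) := by
    change _ = _
    rw [mul_add, add_mul, ha, hb, smul_add]
  smul_mem' c a (ha : _ = _) := by
    change _ = _
    rw [mul_smul_comm, smul_mul_assoc, ha, smul_comm]

lemma mem_parity {i : ZMod 2} {x : Ut l} :
    x ∈ parity l i ↔ xiLast l * x * xiLast l = sgn i • x := Iff.rfl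

instance : SetLike.GradedMonoid (parity l) where
  one_mem := by rw [mem_parity, mul_one, xiLast_mul_self, sgn_zero, one_smul]
  mul_mem i j a b ha hb := by
    rw [mem_parity] at *
    calc xiLast l * (a * b) * xiLast l =
          xiLast l * a * (xiLast l * xiLast l) * b * xiLast l := by
          rw [xiLast_mul_self]; noncomm_ring
      _ = (xiLast l * a * xiLast l) * (xiLast l * b * xiLast l) := by noncomm_ring
      _ = sgn (i + j) • (a * b) := by rw [ha, hb, smul_mul_smul_comm, sgn_add]

/-- The component of degree `i` of `x` is `(x + (-1) ^ i ξ x ξ) / 2`. -/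
def parityProj (i : ZMod 2) (x : Ut l) : parity l i :=
  ⟨(2⁻¹ : kk) • (x + sgn i • (xiLast l * x * xiLast l)), by
    have h : xiLast l * (xiLast l * x * xiLast l) * xiLast l = x := by
      calc _ = (xiLast l * xiLast l) * x * (xiLast l * xiLast l) := by noncomm_ring
        _ = x := by rw [xiLast_mul_self, one_mul, mul_one]
    rw [mem_parity, mul_smul_comm, smul_mul_assoc, smul_comm, mul_add, add_mul, mul_smul_comm,
      smul_mul_assoc, h, smul_add (sgn i) x, smul_smul, sgn_mul_self, one_smul, add_comm]⟩

lemma parityProj_of_mem {i j : ZMod 2} {x : Ut l} (hx : x ∈ parity l j) :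
    (parityProj i x : Ut l) = if j = i then x else 0 := by
  have h : (parityProj i x : Ut l) = (2⁻¹ : kk) • (x + sgn i • (xiLast l * x * xiLast l)) := rfl
  rw [h, mem_parity.1 hx, smul_smul, ← sgn_add]
  split_ifs with hij
  · rw [hij, CharTwo.add_self_eq_zero, sgn_zero, one_smul, ← two_smul kk x, smul_smul,
      inv_mul_cancel₀ two_ne_zero, one_smul]
  · have key : ∀ i j : ZMod 2, ¬ j = i → i + j = 1 := by decide
    rw [key i j hij, sgn_one, neg_smul, one_smul, add_neg_cancel, smul_zero]

instance : GradedAlgebra (parity l) where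
  decompose' x := DirectSum.of (fun i => parity l i) 0 (parityProj 0 x) +
    DirectSum.of (fun i => parity l i) 1 (parityProj 1 x)
  left_inv x := by
    rw [map_add, DirectSum.coeAddMonoidHom_of, DirectSum.coeAddMonoidHom_of, parityProj, parityProj]
    simp only [sgn_zero, sgn_one, one_smul, neg_smul]
    rw [← smul_add, add_add_add_comm, add_neg_cancel, add_zero, ← two_smul kk x, smul_smul,
      inv_mul_cancel₀ two_ne_zero, one_smul]
  right_inv y := by
    have hadd : ∀ (i : ZMod 2) (a b : Ut l), parityProj i (a + b) = parityProj i a + parityProj i b :=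
      fun i a b => Subtype.ext <| by
        simp only [parityProj, Submodule.coe_add, mul_add, add_mul, smul_add]
        abel
    induction y using DirectSum.induction_on with
    | zero =>
      have h0 : ∀ i, parityProj i (0 : Ut l) = 0 := fun i => Subtype.ext <| by simp [parityProj]
      beta_reduce
      rw [map_zero, h0, h0, map_zero, map_zero, add_zero]
    | of n y =>
      refine DFinsupp.ext fun m => Subtype.ext ?_
      rw [DirectSum.coeAddMonoidHom_of, DirectSum.add_apply, Submodule.coe_add,
        DirectSum.coe_of_apply, DirectSum.coe_of_apply, DirectSum.coe_of_apply,
        apply_ite (Subtype.val), apply_ite (Subtype.val), apply_ite (Subtype.val),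
        parityProj_of_mem y.2, parityProj_of_mem y.2]
      have h2 : ∀ c : ZMod 2, c = 0 ∨ c = 1 := by decide
      rcases h2 n with rfl | rfl <;> rcases h2 m with rfl | rfl <;> simp
    | add a b ha hb =>
      beta_reduce at ha hb ⊢
      rw [map_add, hadd, hadd, map_add, map_add, add_add_add_comm, ha, hb]

/-- An element of weight `ν` has parity `(ν, w_l)`. -/
lemma mem_parity_of_weight {ν : P l} {x : Ut l} (hx : x ∈ weightSpace ν) :
    x ∈ parity l (form ν (wlast l) : ℤ) := by
  rw [mem_parity, xiLast, xi_mul_of_weight _ hx, smul_mul_assoc, mul_assoc, xi_mul_self, mul_one,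
    ← form_red, form_comm]

/-! ### The Zhang transformation and the twisted Hopf structure -/

/-- The linear map which is given by `f m` on the component of degree `m` of a graded space. -/
def gradedMap {ι k A B : Type*} [DecidableEq ι] [CommSemiring k] [AddCommMonoid A] [Module k A]
    [AddCommMonoid B] [Module k B] (𝒜 : ι → Submodule k A) [DirectSum.Decomposition 𝒜]
    (f : ι → A →ₗ[k] B) : A →ₗ[k] B :=
  DirectSum.toModule k ι B (fun m => f m ∘ₗ (𝒜 m).subtype) ∘ₗ
    (DirectSum.decomposeLinearEquiv 𝒜).toLinearMap

lemma gradedMap_of_mem {ι k A B : Type*} [DecidableEq ι] [CommSemiring k] [AddCommMonoid A] [Module k A]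
    [AddCommMonoid B] [Module k B] (𝒜 : ι → Submodule k A) [DirectSum.Decomposition 𝒜]
    (f : ι → A →ₗ[k] B) {m : ι} {x : A} (hx : x ∈ 𝒜 m) : gradedMap 𝒜 f x = f m x := by
  rw [gradedMap, LinearMap.comp_apply, LinearEquiv.coe_coe, DirectSum.decomposeLinearEquiv_apply,
    DirectSum.decompose_of_mem 𝒜 hx, ← DirectSum.lof_eq_of k, DirectSum.toModule_lof]
  rfl

/-- The Zhang transformation `Ψ : Ũ → Ũ`, given by `x ↦ ξ_θ x` on the elements of `μ`-degree `θ`. -/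
def Psi (l : ℕ) : Ut l →ₗ[kk] Ut l := gradedMap muSpace (fun θ => LinearMap.mulLeft kk (xi θ))

lemma Psi_of_mem {θ : Q l} {x : Ut l} (hx : x ∈ muSpace θ) : Psi l x = xi θ * x :=
  gradedMap_of_mem _ _ hx

lemma Psi_Psi (x : Ut l) : Psi l (Psi l x) = x := by
  induction x using DirectSum.Decomposition.inductionOn (muSpace (l := l)) with
  | zero => rw [map_zero, map_zero]
  | homogeneous x =>
    rename_i θ
    have h : xi θ * (x : Ut l) ∈ muSpace θ := by
      have := SetLike.GradedMul.mul_mem (xi_mem_piece (degMu l) θ) x.2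
      rwa [zero_add] at this
    rw [Psi_of_mem x.2, Psi_of_mem h, ← mul_assoc, xi_mul_self, one_mul]
  | add a b ha hb => rw [map_add, map_add, ha, hb]

/-- The linear map `x ⊗ y ↦ (-1) ^ (ν(x), ν(y) + η(ν(y))) x ⊗ y`, for weight elements `x`, `y` of
weights `ν(x)`, `ν(y)`. -/
def twist (l : ℕ) : Ut l ⊗[kk] Ut l →ₗ[kk] Ut l ⊗[kk] Ut l :=
  TensorProduct.lift (gradedMap weightSpace fun ν =>
    (TensorProduct.mk kk (Ut l) (Ut l)).compl₂ (gradedMap weightSpace fun ν' =>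
      sgn (formQ (red l ν) (red l ν' + η ν')) • LinearMap.id))

lemma twist_tmul {ν ν' : P l} {x y : Ut l} (hx : x ∈ weightSpace ν) (hy : y ∈ weightSpace ν') :
    twist l (x ⊗ₜ y) = sgn (formQ (red l ν) (red l ν' + η ν')) • x ⊗ₜ y := by
  rw [twist, TensorProduct.lift.tmul, gradedMap_of_mem _ _ hx, LinearMap.compl₂_apply,
    gradedMap_of_mem _ _ hy]
  simp

/-- The twisted coproduct `Δ̄`, which is determined by
`Δ̄ (Ψ a) = ∑ (-1) ^ (ν(a₁), ν(a₂) + η(ν(a₂))) Ψ a₁ ⊗ Ψ a₂` for `Δ a = ∑ a₁ ⊗ a₂` with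
homogeneous `a₁`, `a₂`. Recall that `Ψ` is an involution. -/
def comulBar (l : ℕ) : Ut l →ₗ[kk] Ut l ⊗[kk] Ut l :=
  TensorProduct.map (Psi l) (Psi l) ∘ₗ twist l ∘ₗ (comul l).toLinearMap ∘ₗ Psi l

lemma comulBar_Psi (a : Ut l) :
    comulBar l (Psi l a) = TensorProduct.map (Psi l) (Psi l) (twist l (comul l a)) := by
  simp [comulBar, Psi_Psi]

/-- The linear map `a ↦ (-1) ^ (ν(a), δ(a)) a`, for `a` homogeneous of weight `ν(a)` and of
`δ`-degree `δ(a)`. -/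
def signMap (l : ℕ) : Ut l →ₗ[kk] Ut l :=
  gradedMap weightSpace fun ν => gradedMap deltaSpace fun θ =>
    sgn (formQ (red l ν) θ) • LinearMap.id

lemma signMap_of_mem {ν : P l} {θ : Q l} {a : Ut l} (ha : a ∈ weightSpace ν)
    (ha' : a ∈ deltaSpace θ) : signMap l a = sgn (formQ (red l ν) θ) • a := by
  rw [signMap, gradedMap_of_mem _ _ ha, gradedMap_of_mem _ _ ha']
  simp

/-- The twisted antipode `S̄`, which is determined by `S̄ (Ψ a) = (-1) ^ (ν(a), δ(a)) Ψ (S a)` for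
homogeneous `a`. -/
def antipodeBar (l : ℕ) : Ut l →ₗ[kk] Ut l := Psi l ∘ₗ antipode l ∘ₗ signMap l ∘ₗ Psi l

lemma antipodeBar_Psi {ν : P l} {θ : Q l} {a : Ut l} (ha : a ∈ weightSpace ν)
    (ha' : a ∈ deltaSpace θ) :
    antipodeBar l (Psi l a) = sgn (formQ (red l ν) θ) • Psi l (antipode l a) := by
  simp [antipodeBar, Psi_Psi, signMap_of_mem ha ha']

/-- The image `Ψ(U)` of `U` under the Zhang transformation. -/
def Ubar (l : ℕ) : Submodule kk (Ut l) := (LinearMap.range (incl l).toLinearMap).map (Psi l)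

end

end ZhangOsp

namespace ZhangOsp

open scoped TensorProduct DirectSum

noncomputable section

variable {l : ℕ}

/-! ### The untwisted Hopf structure of `Ũ` -/

/-! Every sign in the statement is governed by the bidegree (ν, δ) in P × P/2P. The μ-degree is a
function of it, μ = δ + η(ν) (`jointSpace_le_muSpace`), so Ψ x = ξ_{δ(x)+η(ν(x))} x for
bihomogeneous x. Moving the ξ of the second factor past the first one gives Ψ(x) Ψ(y) = (-1)^{(μ(y),
ν(x))} Ψ(xy) (`Psi_mul_Psi`). Through Ψ, the product and the coproduct of Ũ are thus both modified
by bicharacters, and each axiom becomes the corresponding axiom of Ũ together with a comparison of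
signs.

The comparison works because the degrees of the two factors of a coproduct are linked: for a of
bidegree (ν, θ), the terms of Δ a satisfy ν(a₁) + ν(a₂) = ν, δ(a₂) = θ and δ(a₁) = θ + ν(a₂)
(`comul_mem_tensorSpace`). When Δ̄(Ψ a) Δ̄(Ψ b) is compared with Δ̄(Ψ a Ψ b), all signs cancel
except (η(ν(b₁)), ν(a₂)) + (ν(b₁), ν(a₂) + η(ν(a₂))). This has to be the Koszul exponent |b₁| |a₂|,
where |x| = (ν(x), w_l). That is the bilinear identity `formQ_η_add`; it is checked on simple roots,
of which only the last one is odd.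

The other axioms are lighter. Coassociativity holds because the sign in Δ̄ is biadditive in the
weights and Δ preserves weights: both iterated coproducts carry the product of the signs of the
three pairs of factors (`twistPsi₃`). The counit satisfies ε ∘ Ψ = ε and kills the nonzero weights,
for which alone the sign could matter. The antipode S preserves ν and shifts δ by ν
(`antipode_mem_jointSpace`). With this shift the signs cancel in one antipode identity, and in the
other they leave the global sign (-1)^{(ν, θ)}, which is 1 when ν = 0 and multiplies ε(a) = 0
otherwise.

Finally, U is spanned by its bihomogeneous elements (`range_incl_le`), and on these the twisted
operations agree with the original ones up to Ψ and signs; hence Ψ(U) is stable. -/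

lemma Ut_hom_ext {A : Type*} [Ring A] [Algebra kk A] {f g : Ut l →ₐ[kk] A}
    (hE : ∀ i, f (tE i) = g (tE i)) (hF : ∀ i, f (tF i) = g (tF i))
    (hK : ∀ μ, f (tK μ) = g (tK μ)) (hξ : ∀ θ, f (xi θ) = g (xi θ)) : f = g := by
  ext1 x
  induction x using Ut_induction with
  | hE i => exact hE i
  | hF i => exact hF i
  | hK μ => exact hK μ
  | hξ θ => exact hξ θ
  | hc c => rw [AlgHom.commutes, AlgHom.commutes]
  | hadd a b ha hb => rw [map_add, map_add, ha, hb]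
  | hmul a b ha hb => rw [map_mul, map_mul, ha, hb]

lemma counit_tE (i : Fin l) : counit l (tE i) = 0 := by
  rw [tE, counit, liftUt_incl, counitU, liftU_E]

lemma counit_tF (i : Fin l) : counit l (tF i) = 0 := by
  rw [tF, counit, liftUt_incl, counitU, liftU_F]

lemma counit_tK (μ : P l) : counit l (tK μ) = 1 := by
  rw [tK, counit, liftUt_incl, counitU, liftU_K]

lemma counit_xi (θ : Q l) : counit l (xi θ) = 1 := by
  rw [counit, liftUt_xi]; rfl

/-- Both sides are values of algebra morphisms, so it suffices to compare them on the generators.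
The two counit identities are obtained in the same way. -/
lemma comul_coassoc (a : Ut l) :
    TensorProduct.assoc kk (Ut l) (Ut l) (Ut l) ((comul l).toLinearMap.rTensor (Ut l) (comul l a)) =
      (comul l).toLinearMap.lTensor (Ut l) (comul l a) := by
  have h : ((Algebra.TensorProduct.assoc kk kk kk (Ut l) (Ut l) (Ut l)).toAlgHom.comp
      (Algebra.TensorProduct.map (comul l) (AlgHom.id kk (Ut l)))).comp (comul l) =
      (Algebra.TensorProduct.map (AlgHom.id kk (Ut l)) (comul l)).comp (comul l) := by
    apply Ut_hom_ext <;> intro i <;>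
    simp [comul_tE, comul_tF, comul_tK, comul_xi, TensorProduct.add_tmul, TensorProduct.tmul_add,
      Algebra.TensorProduct.one_def, add_assoc]
  exact DFunLike.congr_fun h a

lemma counit_comul (a : Ut l) :
    TensorProduct.lid kk (Ut l) ((counit l).toLinearMap.rTensor (Ut l) (comul l a)) = a := by
  have h : ((Algebra.TensorProduct.lid kk (Ut l)).toAlgHom.comp
      (Algebra.TensorProduct.map (counit l) (AlgHom.id kk (Ut l)))).comp (comul l) =
      AlgHom.id kk (Ut l) := by
    apply Ut_hom_ext <;> intro i <;>
    simp [comul_tE, comul_tF, comul_tK, comul_xi, counit_tE, counit_tF, counit_tK, counit_xi]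
  exact DFunLike.congr_fun h a

lemma comul_counit (a : Ut l) :
    TensorProduct.rid kk (Ut l) ((counit l).toLinearMap.lTensor (Ut l) (comul l a)) = a := by
  have h : ((Algebra.TensorProduct.rid kk kk (Ut l)).toAlgHom.comp
      (Algebra.TensorProduct.map (AlgHom.id kk (Ut l)) (counit l))).comp (comul l) =
      AlgHom.id kk (Ut l) := by
    apply Ut_hom_ext <;> intro i <;>
    simp [comul_tE, comul_tF, comul_tK, comul_xi, counit_tE, counit_tF, counit_tK, counit_xi]
  exact DFunLike.congr_fun h a

/-! ### The antipode identities of Ũ. -/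

lemma antipode_one : antipode l 1 = 1 := by
  rw [← xi_zero, antipode_xi]

/-- Since S reverses products, X (y ⊗ z) is sent to S(y) m z, where m is the image of X. If m is a
scalar it can be pulled out. This is what carries the antipode identity from two elements to their
product, although a ↦ S(a₁) a₂ is not a morphism. -/
lemma mul_antipode_rTensor_mul {c : kk} {X : Ut l ⊗[kk] Ut l}
    (hX : LinearMap.mul' kk (Ut l) ((antipode l).rTensor (Ut l) X) = algebraMap kk (Ut l) c)
    (Y : Ut l ⊗[kk] Ut l) :
    LinearMap.mul' kk (Ut l) ((antipode l).rTensor (Ut l) (X * Y)) =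
      c • LinearMap.mul' kk (Ut l) ((antipode l).rTensor (Ut l) Y) := by
  induction Y using TensorProduct.induction_on with
  | zero => simp
  | tmul y z =>
    have h : LinearMap.mul' kk (Ut l) ((antipode l).rTensor (Ut l) (X * y ⊗ₜ z)) =
        antipode l y * LinearMap.mul' kk (Ut l) ((antipode l).rTensor (Ut l) X) * z := by
      -- The identity holds for every tensor `X`; the hypothesis that the image of `X` is a scalar
      -- would not pass to the summands in the induction.
      clear hX
      induction X using TensorProduct.induction_on with
      | zero => simp
      | tmul u v => simp [antipode_mul, mul_assoc]
      | add u v hu hv => simp only [add_mul, map_add, hu, hv, mul_add]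
    rw [h, hX, ← Algebra.commutes, mul_assoc, ← Algebra.smul_def]
    simp
  | add u v hu hv => simp only [mul_add, map_add, hu, hv, smul_add]

/-- Mirror image of `mul_antipode_rTensor_mul`: the second factor `Y` is now the inner one, and its
image sits between y and S(z). -/
lemma mul_antipode_lTensor_mul {c : kk} {Y : Ut l ⊗[kk] Ut l}
    (hY : LinearMap.mul' kk (Ut l) ((antipode l).lTensor (Ut l) Y) = algebraMap kk (Ut l) c)
    (X : Ut l ⊗[kk] Ut l) :
    LinearMap.mul' kk (Ut l) ((antipode l).lTensor (Ut l) (X * Y)) =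
      c • LinearMap.mul' kk (Ut l) ((antipode l).lTensor (Ut l) X) := by
  induction X using TensorProduct.induction_on with
  | zero => simp
  | tmul y z =>
    have h : LinearMap.mul' kk (Ut l) ((antipode l).lTensor (Ut l) (y ⊗ₜ z * Y)) =
        y * LinearMap.mul' kk (Ut l) ((antipode l).lTensor (Ut l) Y) * antipode l z := by
      clear hY
      induction Y using TensorProduct.induction_on with
      | zero => simp
      | tmul u v => simp [antipode_mul, mul_assoc]
      | add u v hu hv => simp only [add_mul, map_add, hu, hv, mul_add]
    rw [h, hY, ← Algebra.commutes, mul_assoc, ← Algebra.smul_def]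
    simp
  | add u v hu hv => simp only [add_mul, map_add, hu, hv, smul_add]

lemma mul_antipode_rTensor_comul (a : Ut l) :
    LinearMap.mul' kk (Ut l) ((antipode l).rTensor (Ut l) (comul l a)) =
      algebraMap kk (Ut l) (counit l a) := by
  induction a using Ut_induction with
  | hE i => simp [comul_tE, antipode_tE, antipode_tK, counit_tE]
  | hF i => simp [comul_tF, antipode_tF, antipode_one, counit_tF, mul_assoc, tK_mul_inv]
  | hK μ => simp [comul_tK, antipode_tK, counit_tK, tK_inv_mul]
  | hξ θ => simp [comul_xi, antipode_xi, counit_xi, xi_mul_self]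
  | hc c =>
    simp [Algebra.algebraMap_eq_smul_one (A := Ut l), Algebra.TensorProduct.one_def, antipode_one]
  | hadd a b ha hb => simp only [map_add, ha, hb]
  | hmul a b ha hb =>
    rw [map_mul, mul_antipode_rTensor_mul ha, hb, map_mul, map_mul, ← Algebra.smul_def]

lemma mul_antipode_lTensor_comul (a : Ut l) :
    LinearMap.mul' kk (Ut l) ((antipode l).lTensor (Ut l) (comul l a)) =
      algebraMap kk (Ut l) (counit l a) := by
  induction a using Ut_induction with
  | hE i => simp [comul_tE, antipode_tE, antipode_one, counit_tE, ← mul_assoc, tK_mul_inv]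
  | hF i => simp [comul_tF, antipode_tF, antipode_tK, counit_tF]
  | hK μ => simp [comul_tK, antipode_tK, counit_tK, tK_mul_inv]
  | hξ θ => simp [comul_xi, antipode_xi, counit_xi, xi_mul_self]
  | hc c =>
    simp [Algebra.algebraMap_eq_smul_one (A := Ut l), Algebra.TensorProduct.one_def, antipode_one]
  | hadd a b ha hb => simp only [map_add, ha, hb]
  | hmul a b ha hb =>
    rw [map_mul, mul_antipode_lTensor_mul hb, ha, map_mul, map_mul, Algebra.commutes,
      ← Algebra.smul_def]

/-! ### The gradation by the weight and the `δ`-degree -/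

/-- The degrees for the gradation by the weight and the `δ`-degree. -/
def degJoint (l : ℕ) : Deg l (P l × Q l) where
  E i := (α i, 0)
  F i := (-α i, red l (α i))
  K := AddMonoidHom.prod 0 (red l)
  E_F i := by ext1 <;> simp
  E_F_neg i := by
    ext1
    · simp
    · simpa using (red_neg (α i)).symm

/-- The space of the elements of weight `ν` and `δ`-degree `θ`. -/
abbrev jointSpace (ν : P l) (θ : Q l) : Submodule kk (Ut l) := piece (degJoint l) (ν, θ)

/-- By `coeff_mem` the component of x in degree m lies in W m, and a homogeneous x is its own
component. Any statement about degrees that is stable under sums and products can therefore be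
checked on the generators. -/
lemma mem_of_mem_piece {M : Type} [AddCommGroup M] (d : Deg l M) (W : M → Submodule kk (Ut l))
    [SetLike.GradedMonoid W] (hE : ∀ i, tE i ∈ W (d.E i)) (hF : ∀ i, tF i ∈ W (d.F i))
    (hK : ∀ μ, tK μ ∈ W (d.K μ)) (hξ : ∀ θ, xi θ ∈ W 0) {m : M} {x : Ut l} (hx : x ∈ piece d m) :
    x ∈ W m := by
  have h := (coeff_mem d W hE hF hK hξ x m).1
  rwa [(mem_piece _).1 hx, AddMonoidAlgebra.coeff_single, Finsupp.single_eq_same] at h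

/-- A graded family of subspaces which contains the generators contains the components of the
gradation. -/
lemma mem_of_mem_jointSpace (W : P l → Q l → Submodule kk (Ut l)) (h1 : 1 ∈ W 0 0)
    (hmul : ∀ ν ν' θ θ' a b, a ∈ W ν θ → b ∈ W ν' θ' → a * b ∈ W (ν + ν') (θ + θ'))
    (hE : ∀ i, tE i ∈ W (α i) 0) (hF : ∀ i, tF i ∈ W (-α i) (red l (α i)))
    (hK : ∀ μ, tK μ ∈ W 0 (red l μ)) (hξ : ∀ θ, xi θ ∈ W 0 0) {ν : P l} {θ : Q l} {x : Ut l}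
    (hx : x ∈ jointSpace ν θ) : x ∈ W ν θ := by
  have : SetLike.GradedMonoid (fun m : P l × Q l => W m.1 m.2) :=
    { one_mem := h1
      mul_mem := fun m n a b ha hb => hmul m.1 n.1 m.2 n.2 a b ha hb }
  exact mem_of_mem_piece (degJoint l) (fun m => W m.1 m.2) hE hF hK hξ hx

lemma tE_mem_jointSpace (i : Fin l) : tE i ∈ jointSpace (α i) 0 := tE_mem_piece (degJoint l) i

lemma tF_mem_jointSpace (i : Fin l) : tF i ∈ jointSpace (-α i) (red l (α i)) :=
  tF_mem_piece (degJoint l) i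

lemma tK_mem_jointSpace (μ : P l) : tK μ ∈ jointSpace 0 (red l μ) := tK_mem_piece (degJoint l) μ

lemma xi_mem_jointSpace (θ : Q l) : xi θ ∈ jointSpace 0 0 := xi_mem_piece (degJoint l) θ

lemma mul_mem_jointSpace {ν ν' : P l} {θ θ' : Q l} {x y : Ut l} (hx : x ∈ jointSpace ν θ)
    (hy : y ∈ jointSpace ν' θ') : x * y ∈ jointSpace (ν + ν') (θ + θ') :=
  SetLike.GradedMul.mul_mem (A := piece (degJoint l)) hx hy

lemma one_mem_jointSpace : (1 : Ut l) ∈ jointSpace 0 0 :=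
  SetLike.GradedOne.one_mem (A := piece (degJoint l))

lemma jointSpace_le_weightSpace {ν : P l} {θ : Q l} : jointSpace ν θ ≤ weightSpace ν :=
  fun _ hx => mem_of_mem_jointSpace (fun ν _ => weightSpace ν)
    (SetLike.GradedOne.one_mem (A := weightSpace))
    (fun _ _ _ _ _ _ ha hb => SetLike.GradedMul.mul_mem ha hb)
    tE_mem_weightSpace tF_mem_weightSpace tK_mem_weightSpace xi_mem_weightSpace hx

lemma jointSpace_le_deltaSpace {ν : P l} {θ : Q l} : jointSpace ν θ ≤ deltaSpace θ :=
  fun _ hx => mem_of_mem_jointSpace (fun _ θ => deltaSpace θ)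
    (SetLike.GradedOne.one_mem (A := piece (degDelta l)))
    (fun _ _ _ _ _ _ ha hb => SetLike.GradedMul.mul_mem (A := piece (degDelta l)) ha hb)
    (tE_mem_piece (degDelta l)) (tF_mem_piece (degDelta l)) (tK_mem_piece (degDelta l))
    (xi_mem_piece (degDelta l)) hx

lemma η_zero : η (0 : P l) = 0 := by simp [η, form_zero_left]

lemma η_neg (v : P l) : η (-v) = η v := by
  have h := η_add v (-v)
  rw [add_neg_cancel, η_zero] at h
  rw [← add_zero (η v), h, ← add_assoc, Q_add_self, zero_add]

/-- The degrees μ and δ + η(ν) are both additive, so they need only be compared on the generators.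
For F_i the comparison is α_i + β_{i+1} = β_i modulo 2P. -/
lemma jointSpace_le_muSpace {ν : P l} {θ : Q l} : jointSpace ν θ ≤ muSpace (θ + η ν) := by
  refine fun x hx => mem_of_mem_jointSpace (fun ν θ => muSpace (θ + η ν)) ?_
    (fun ν ν' θ θ' a b ha hb => ?_) (fun i => ?_) (fun i => ?_) (fun μ => ?_) (fun θ => ?_) hx
  · rw [η_zero, add_zero]
    exact SetLike.GradedOne.one_mem (A := piece (degMu l))
  · rw [η_add, add_add_add_comm]
    exact SetLike.GradedMul.mul_mem (A := piece (degMu l)) ha hb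
  · rw [zero_add, η_α]
    exact tE_mem_piece (degMu l) i
  · rw [η_neg, η_α, ← red_βsucc_add, add_right_comm, Q_add_self, zero_add]
    exact tF_mem_piece (degMu l) i
  · rw [η_zero, add_zero]
    exact tK_mem_piece (degMu l) μ
  · rw [η_zero, add_zero]
    exact xi_mem_piece (degMu l) θ

/-- The factor K_{±α_i} in S(E_i) and S(F_i) has weight 0 and δ-degree α_i, which is the weight of
E_i and F_i modulo 2P. The shift is additive in ν, so it is compatible with products, and the
reversal of the factors by S does not affect degrees. -/
lemma antipode_mem_jointSpace {ν : P l} {θ : Q l} {x : Ut l} (hx : x ∈ jointSpace ν θ) :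
    antipode l x ∈ jointSpace ν (θ + red l ν) := by
  rw [← Submodule.mem_comap (f := antipode l)]
  refine mem_of_mem_jointSpace (fun ν θ => (jointSpace ν (θ + red l ν)).comap (antipode l)) ?_
    (fun ν ν' θ θ' a b ha hb => ?_) (fun i => ?_) (fun i => ?_) (fun μ => ?_) (fun θ => ?_) hx <;>
    rw [Submodule.mem_comap] at *
  · rw [antipode_one, map_zero, add_zero]
    exact one_mem_jointSpace
  · have h := mul_mem_jointSpace hb ha
    rwa [← antipode_mul, add_add_add_comm, ← map_add, add_comm ν', add_comm θ'] at h
  · have h := mul_mem_jointSpace (tK_mem_jointSpace (-α i)) (tE_mem_jointSpace i)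
    rw [zero_add, red_neg, add_zero] at h
    rw [antipode_tE, zero_add]
    exact Submodule.neg_mem _ h
  · have h := mul_mem_jointSpace (tF_mem_jointSpace i) (tK_mem_jointSpace (α i))
    rw [add_zero, ← red_neg, red_neg (α i)] at h
    rw [antipode_tF, red_neg]
    exact Submodule.neg_mem _ h
  · rw [antipode_tK, map_zero, add_zero, ← red_neg]
    exact tK_mem_jointSpace (-μ)
  · rw [antipode_xi, map_zero, add_zero]
    exact xi_mem_jointSpace θ

/-! ### Degrees of the two factors of a coproduct. -/

/-- The space spanned by the tensors `x ⊗ y` with `x` of weight `ν₁` and of `δ`-degree `θ + ν₂`, and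
`y` of weight `ν₂` and of `δ`-degree `θ`, where `ν₁ + ν₂ = ν`. -/
def tensorSpace (ν : P l) (θ : Q l) : Submodule kk (Ut l ⊗[kk] Ut l) :=
  Submodule.span kk {X | ∃ ν₁ ν₂ : P l, ∃ x y : Ut l, ν₁ + ν₂ = ν ∧
    x ∈ jointSpace ν₁ (θ + red l ν₂) ∧ y ∈ jointSpace ν₂ θ ∧ X = x ⊗ₜ y}

lemma tmul_mem_tensorSpace {ν ν₁ ν₂ : P l} {θ θ₁ : Q l} {x y : Ut l}
    (hx : x ∈ jointSpace ν₁ θ₁) (hy : y ∈ jointSpace ν₂ θ) (hν : ν₁ + ν₂ = ν)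
    (hθ : θ₁ = θ + red l ν₂) : x ⊗ₜ y ∈ tensorSpace ν θ :=
  Submodule.subset_span ⟨ν₁, ν₂, x, y, hν, hθ ▸ hx, hy, rfl⟩

/-- Two linear maps agree on `tensorSpace ν θ` as soon as they agree on its generators. -/
lemma eq_of_mem_tensorSpace {A : Type*} [AddCommGroup A] [Module kk A] {ν : P l} {θ : Q l}
    {f g : Ut l ⊗[kk] Ut l →ₗ[kk] A}
    (h : ∀ ν₁ ν₂ x y, ν₁ + ν₂ = ν → x ∈ jointSpace ν₁ (θ + red l ν₂) → y ∈ jointSpace ν₂ θ →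
      f (x ⊗ₜ y) = g (x ⊗ₜ y)) {X : Ut l ⊗[kk] Ut l} (hX : X ∈ tensorSpace ν θ) : f X = g X := by
  refine LinearMap.eqOn_span ?_ hX
  rintro _ ⟨ν₁, ν₂, x, y, e, hx, hy, rfl⟩
  exact h ν₁ ν₂ x y e hx hy

lemma mul_mem_tensorSpace {ν ν' : P l} {θ θ' : Q l} {X Y : Ut l ⊗[kk] Ut l}
    (hX : X ∈ tensorSpace ν θ) (hY : Y ∈ tensorSpace ν' θ') :
    X * Y ∈ tensorSpace (ν + ν') (θ + θ') := by
  have h := Submodule.mul_mem_mul hX hY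
  rw [tensorSpace, tensorSpace, Submodule.span_mul_span] at h
  refine Submodule.span_le.2 ?_ h
  rintro _ ⟨_, ⟨ν₁, ν₂, x, y, rfl, hx, hy, rfl⟩, _, ⟨ν₁', ν₂', x', y', rfl, hx', hy', rfl⟩, rfl⟩
  change (x ⊗ₜ y) * (x' ⊗ₜ y') ∈ tensorSpace _ _
  rw [Algebra.TensorProduct.tmul_mul_tmul]
  refine tmul_mem_tensorSpace (mul_mem_jointSpace hx hx') (mul_mem_jointSpace hy hy')
    (add_add_add_comm _ _ _ _) ?_
  rw [map_add, add_add_add_comm]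

/-- The condition is stable under products and holds on the generators. The shift by ν₂ in the first
factor is forced by K_{α_i} ⊗ E_i, where K_{α_i} has δ-degree α_i while E_i has δ-degree 0; in 1 ⊗
F_i it cancels the δ-degree α_i of F_i, as -α_i = α_i modulo 2P. -/
lemma comul_mem_tensorSpace {ν : P l} {θ : Q l} {x : Ut l} (hx : x ∈ jointSpace ν θ) :
    comul l x ∈ tensorSpace ν θ := by
  have h1 := one_mem_jointSpace (l := l)
  refine mem_of_mem_jointSpace (fun ν θ => (tensorSpace ν θ).comap (comul l).toLinearMap) ?_
    (fun ν ν' θ θ' a b ha hb => ?_) (fun i => ?_) (fun i => ?_) (fun μ => ?_) (fun θ => ?_) hx <;>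
    rw [Submodule.mem_comap, AlgHom.toLinearMap_apply] at *
  · rw [map_one]
    exact tmul_mem_tensorSpace h1 h1 (add_zero 0) (by rw [map_zero, add_zero])
  · rw [map_mul]
    exact mul_mem_tensorSpace ha hb
  · rw [comul_tE]
    exact Submodule.add_mem _
      (tmul_mem_tensorSpace (tE_mem_jointSpace i) h1 (add_zero _) (by rw [map_zero, add_zero]))
      (tmul_mem_tensorSpace (tK_mem_jointSpace _) (tE_mem_jointSpace i) (zero_add _)
        (by rw [zero_add]))
  · rw [comul_tF]
    refine Submodule.add_mem _
      (tmul_mem_tensorSpace (tF_mem_jointSpace i) ?_ (add_zero _) (by rw [map_zero, add_zero]))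
      (tmul_mem_tensorSpace h1 (tF_mem_jointSpace i) (zero_add _) (by rw [red_neg, Q_add_self]))
    rw [← red_neg]
    exact tK_mem_jointSpace _
  · rw [comul_tK]
    exact tmul_mem_tensorSpace (tK_mem_jointSpace μ) (tK_mem_jointSpace μ) (add_zero 0)
      (by rw [map_zero, add_zero])
  · rw [comul_xi]
    exact tmul_mem_tensorSpace (xi_mem_jointSpace θ) (xi_mem_jointSpace θ) (add_zero 0)
      (by rw [map_zero, add_zero])

/-! ### The Zhang transformation on homogeneous elements -/

lemma formQ_comm (u v : Q l) : formQ u v = formQ v u := by simp [formQ, mul_comm]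

/-! ### The parity bicharacter on P. -/

lemma P_induction {p : P l → Prop} (h0 : p 0) (hadd : ∀ u v, p u → p v → p (u + v))
    (hneg : ∀ u, p u → p (-u)) (hα : ∀ i, p (α i)) (v : P l) : p v := by
  let G : AddSubgroup (P l) :=
    { carrier := {v | p v}
      zero_mem' := h0
      add_mem' := fun {u v} hu hv => hadd u v hu hv
      neg_mem' := fun {u} hu => hneg u hu }
  -- The simple roots generate P, the coordinates of v being the numbers (v, w_i).
  have h : ∑ i, form v (w i) • α i ∈ G :=
    AddSubgroup.sum_mem G fun i _ => AddSubgroup.zsmul_mem G (hα i) _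
  rwa [← eq_sum_form_w] at h

lemma α_apply (i j : Fin l) :
    α i j = (if i = j then 1 else 0) - (if (i : ℕ) + 1 = j then 1 else 0) := by
  rw [α, Pi.sub_apply, βsucc_apply, β, Pi.single_apply]
  simp only [eq_comm]

/-- Pairing with w_l reads off the coefficient of the last simple root, the short one; it is the
only odd simple root. -/
lemma form_α_wlast (i : Fin l) : form (α i) (wlast l) = if (i : ℕ) + 1 < l then 0 else 1 := by
  have hi := i.2
  -- The vector w_l is the last of the `w i`; its index is l - 1 because `Fin l` starts at 0.
  have h : wlast l = w (⟨l - 1, by omega⟩ : Fin l) := by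
    refine Finset.sum_congr (Finset.ext fun j => ?_) fun _ _ => rfl
    simp only [Finset.mem_univ, Finset.mem_Iic, Fin.le_def, true_iff]
    omega
  rw [h, form_α_w]
  simp only [Fin.ext_iff]
  split_ifs <;> first | rfl | omega

/-- Writing β_{i+1} = β_i - α_i turns the left side into (β_i, α_j) + (α_i, β_j) - (α_i, α_j). For i
≠ j the terms cancel; for i = j this is 2 - (α_i, α_i), which is 1 for the short root and 0
otherwise. -/
lemma form_βsucc_α_add (i j : Fin l) :
    form (βsucc i) (α j) + form (α i) (β j) = form (α i) (wlast l) * form (α j) (wlast l) := by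
  have h : βsucc i = β i + -α i := by rw [α]; abel
  rw [h, form_add_left, form_neg_left, form_comm (β i), form_β, form_β, form_α_α, α_apply, α_apply,
    form_α_wlast, form_α_wlast]
  have hij : i = j ↔ (i : ℕ) = j := Fin.ext_iff
  have hji : j = i ↔ (i : ℕ) = j := by rw [eq_comm, hij]
  simp only [hij, hji]
  have hi := i.2
  have hj := j.2
  split_ifs <;> omega

/-- The bicharacters `(η u, v)` and `(u, v + η v)` differ by the parity bicharacter. -/
lemma formQ_η_add (u v : P l) : formQ (η u) (red l v) + formQ (red l u) (red l v + η v) =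
    (form u (wlast l) : ZMod 2) * (form v (wlast l) : ZMod 2) := by
  induction u using P_induction with
  | h0 => simp [η_zero, formQ_zero_left, form_zero_left]
  | hadd u u' h h' =>
    rw [η_add, map_add, formQ_add_left, formQ_add_left, form_add_left, Int.cast_add, add_mul,
      add_add_add_comm, h, h']
  | hneg u h => rw [η_neg, red_neg, h, form_neg_left, Int.cast_neg, CharTwo.neg_eq]
  | hα i =>
    induction v using P_induction with
    | h0 => simp [η_zero, formQ_zero_right, form_zero_left]
    | hadd v v' h h' =>
      rw [η_add, map_add, add_add_add_comm, formQ_add_right, formQ_add_right, form_add_left,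
        Int.cast_add, mul_add, add_add_add_comm, h, h']
    | hneg u h => rw [η_neg, red_neg, h, form_neg_left, Int.cast_neg, CharTwo.neg_eq]
    | hα j =>
      -- Modulo 2P, v + η(v) is β_j for v = α_j, so the claim is the reduction modulo 2 of the
      -- integer identity `form_βsucc_α_add`.
      have h : red l (α j) + red l (βsucc j) = red l (β j) := by
        rw [← map_add, α, sub_add_cancel]
      rw [η_α, η_α, h, ← form_red, ← form_red, ← Int.cast_add, form_βsucc_α_add, Int.cast_mul]

/-- Two linear maps on `Ũ` which agree on the homogeneous elements are equal. -/
lemma eq_of_jointSpace {A : Type*} [AddCommGroup A] [Module kk A] {f g : Ut l →ₗ[kk] A}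
    (h : ∀ ν θ, ∀ x ∈ jointSpace ν θ, f x = g x) : f = g := by
  refine LinearMap.ext fun x => ?_
  induction x using DirectSum.Decomposition.inductionOn (piece (degJoint l)) with
  | zero => rw [map_zero, map_zero]
  | homogeneous x => exact h _ _ _ x.2
  | add a b ha hb => rw [map_add, map_add, ha, hb]

/-! ### Ψ, the bidegree and the product. -/

lemma exists_Psi (x : Ut l) : ∃ y, Psi l y = x := ⟨Psi l x, Psi_Psi x⟩

lemma Psi_of_mem_jointSpace {ν : P l} {θ : Q l} {x : Ut l} (hx : x ∈ jointSpace ν θ) :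
    Psi l x = xi (θ + η ν) * x :=
  Psi_of_mem (jointSpace_le_muSpace hx)

lemma Psi_mem_jointSpace {ν : P l} {θ : Q l} {x : Ut l} (hx : x ∈ jointSpace ν θ) :
    Psi l x ∈ jointSpace ν θ := by
  have h := mul_mem_jointSpace (xi_mem_jointSpace (θ + η ν)) hx
  rwa [← Psi_of_mem_jointSpace hx, zero_add, zero_add] at h

lemma Psi_mem_parity {ν : P l} {θ : Q l} {x : Ut l} (hx : x ∈ jointSpace ν θ) :
    Psi l x ∈ parity l (form ν (wlast l) : ℤ) :=
  mem_parity_of_weight (jointSpace_le_weightSpace (Psi_mem_jointSpace hx))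

lemma Psi_one : Psi l 1 = 1 := by
  rw [Psi_of_mem_jointSpace one_mem_jointSpace, η_zero, add_zero, xi_zero, one_mul]

lemma counit_Psi (x : Ut l) : counit l (Psi l x) = counit l x := by
  have h : (counit l).toLinearMap ∘ₗ Psi l = (counit l).toLinearMap :=
    eq_of_jointSpace fun ν θ x hx => by
      rw [LinearMap.comp_apply, Psi_of_mem_jointSpace hx, AlgHom.toLinearMap_apply,
        AlgHom.toLinearMap_apply, map_mul, counit_xi, one_mul]
  exact DFunLike.congr_fun h x

/-- The element ξ_{μ(y)} has to cross x, at the cost of (-1)^{(μ(y), ν(x))}; it then merges with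
ξ_{μ(x)} into ξ_{μ(xy)}, since μ is additive. -/
lemma Psi_mul_Psi {ν ν' : P l} {θ θ' : Q l} {x y : Ut l} (hx : x ∈ jointSpace ν θ)
    (hy : y ∈ jointSpace ν' θ') :
    Psi l x * Psi l y = sgn (formQ (θ' + η ν') (red l ν)) • Psi l (x * y) := by
  rw [Psi_of_mem_jointSpace hx, Psi_of_mem_jointSpace hy,
    Psi_of_mem_jointSpace (mul_mem_jointSpace hx hy), η_add, add_add_add_comm,
    xi_add (θ + η ν),
    mul_assoc (xi _) (xi _), ← mul_assoc (xi (θ' + _)) x,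
    xi_mul_of_weight (θ' + η ν') (jointSpace_le_weightSpace hx)]
  simp only [smul_mul_assoc, mul_smul_comm, smul_smul, sgn_mul_self, one_smul, mul_assoc]

/-- The map `x ⊗ y ↦ (-1) ^ (ν(x), ν(y) + η(ν(y))) Ψ x ⊗ Ψ y`. -/
def twistPsi (l : ℕ) : Ut l ⊗[kk] Ut l →ₗ[kk] Ut l ⊗[kk] Ut l :=
  TensorProduct.map (Psi l) (Psi l) ∘ₗ twist l

lemma comulBar_Psi_eq (a : Ut l) : comulBar l (Psi l a) = twistPsi l (comul l a) := comulBar_Psi a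

lemma twistPsi_tmul {ν ν' : P l} {θ θ' : Q l} {x y : Ut l} (hx : x ∈ jointSpace ν θ)
    (hy : y ∈ jointSpace ν' θ') :
    twistPsi l (x ⊗ₜ y) = sgn (formQ (red l ν) (red l ν' + η ν')) • Psi l x ⊗ₜ Psi l y := by
  rw [twistPsi, LinearMap.comp_apply,
    twist_tmul (jointSpace_le_weightSpace hx) (jointSpace_le_weightSpace hy), map_smul,
    TensorProduct.map_tmul]

/-! ### Multiplicativity of the twisted coproduct -/

/-- The sign rule of the graded tensor product is expressed with powers of the unit -1 of ℤ; this
converts it to `sgn`. -/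
lemma units_pow_smul {A : Type*} [AddCommGroup A] [Module kk A] (a : ZMod 2) (x : A) :
    ((-1 : ℤˣ) ^ a) • x = sgn a • x := by
  have h : ∀ c : ZMod 2, c = 0 ∨ c = 1 := by decide
  rcases h a with rfl | rfl
  · rw [uzpow_zero, one_smul, sgn_zero, one_smul]
  · rw [uzpow_one, sgn_one, neg_smul, one_smul, Units.neg_smul, one_smul]

/-- The sign count behind the multiplicativity of Δ̄. The sign on the right depends only on the
total degrees, and it is the one that `Psi_mul_Psi` produces for elements of these degrees. -/
lemma twistPsi_mul_aux {ν₁ ν₂ ν₁' ν₂' : P l} {θ θ' : Q l} {x y x' y' : Ut l}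
    (hx : x ∈ jointSpace ν₁ (θ + red l ν₂)) (hy : y ∈ jointSpace ν₂ θ)
    (hx' : x' ∈ jointSpace ν₁' (θ' + red l ν₂')) (hy' : y' ∈ jointSpace ν₂' θ') :
    GradedTensorProduct.of kk (parity l) (parity l) (twistPsi l (x ⊗ₜ y)) *
      GradedTensorProduct.of kk (parity l) (parity l) (twistPsi l (x' ⊗ₜ y')) =
    sgn (formQ (θ' + η (ν₁' + ν₂')) (red l (ν₁ + ν₂))) •
      GradedTensorProduct.of kk (parity l) (parity l) (twistPsi l (x ⊗ₜ y * x' ⊗ₜ y')) := by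
  -- In the graded product Ψ y crosses Ψ x', which gives the Koszul sign of the parities (ν₂, w_l)
  -- and (ν₁', w_l).
  have h := GradedTensorProduct.tmul_coe_mul_coe_tmul (R := kk) (parity l) (parity l) (Psi l x)
    ⟨_, Psi_mem_parity hy⟩ ⟨_, Psi_mem_parity hx'⟩ (Psi l y')
  rw [Psi_mul_Psi hx hx', Psi_mul_Psi hy hy', units_pow_smul] at h
  rw [twistPsi_tmul hx hy, twistPsi_tmul hx' hy', Algebra.TensorProduct.tmul_mul_tmul,
    twistPsi_tmul (mul_mem_jointSpace hx hx') (mul_mem_jointSpace hy hy'), map_smul, map_smul,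
    map_smul, smul_mul_smul_comm]
  change _ • ((Psi l x) ᵍ⊗ₜ[kk] (Psi l y) * (Psi l x') ᵍ⊗ₜ[kk] (Psi l y')) = _
  rw [h]
  change _ • _ • GradedTensorProduct.of kk (parity l) (parity l) (_ ⊗ₜ _) = _
  rw [TensorProduct.tmul_smul, ← TensorProduct.smul_tmul', map_smul, map_smul]
  simp only [smul_smul, ← sgn_add]
  congr 2
  -- The term (ν₂', ν₁) coming from the shifted δ-degree of x' cancels (ν₁, ν₂'), and (η(ν₂'), ν₁)
  -- occurs twice. What is left besides the Koszul sign is (η(ν₁'), ν₂) + (ν₁', ν₂ + η(ν₂)), which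
  -- is exactly the left side of `key`.
  have key := formQ_η_add ν₁' ν₂
  rw [formQ_comm (red l ν₁')] at key
  simp only [η_add, map_add, formQ_add_left, formQ_add_right] at key ⊢
  clear h
  grind [formQ_comm]

/-- The sign in `twistPsi_mul_aux` is the same for all pairs of generating tensors, so the formula
extends bilinearly to their spans. Applied to coproducts, it yields the sign that cancels against
`Psi_mul_Psi` in `comulBar_mul`. -/
lemma of_twistPsi_mul {ν ν' : P l} {θ θ' : Q l} {X Y : Ut l ⊗[kk] Ut l}
    (hX : X ∈ tensorSpace ν θ) (hY : Y ∈ tensorSpace ν' θ') :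
    GradedTensorProduct.of kk (parity l) (parity l) (twistPsi l X) *
      GradedTensorProduct.of kk (parity l) (parity l) (twistPsi l Y) =
    sgn (formQ (θ' + η ν') (red l ν)) •
      GradedTensorProduct.of kk (parity l) (parity l) (twistPsi l (X * Y)) := by
  induction hX, hY using Submodule.span_induction₂ with
  | mem_mem X Y hX hY =>
    obtain ⟨ν₁, ν₂, x, y, rfl, hx, hy, rfl⟩ := hX
    obtain ⟨ν₁', ν₂', x', y', rfl, hx', hy', rfl⟩ := hY
    exact twistPsi_mul_aux hx hy hx' hy'
  | zero_left Y hY => simp only [map_zero, zero_mul, smul_zero]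
  | zero_right X hX => simp only [map_zero, mul_zero, smul_zero]
  | add_left X X' Y _ _ _ h h' => simp only [map_add, add_mul, smul_add, h, h']
  | add_right X Y Y' _ _ _ h h' => simp only [map_add, mul_add, smul_add, h, h']
  | smul_left c X Y _ _ h =>
    rw [smul_mul_assoc, map_smul, map_smul, map_smul, map_smul, smul_mul_assoc, h, smul_comm]
  | smul_right c X Y _ _ h =>
    rw [mul_smul_comm, map_smul, map_smul, map_smul, map_smul, mul_smul_comm, h, smul_comm]

lemma comulBar_mul (a b : Ut l) :
    GradedTensorProduct.of kk (parity l) (parity l) (comulBar l (a * b)) =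
      GradedTensorProduct.of kk (parity l) (parity l) (comulBar l a) *
        GradedTensorProduct.of kk (parity l) (parity l) (comulBar l b) := by
  obtain ⟨a, rfl⟩ := exists_Psi a
  obtain ⟨b, rfl⟩ := exists_Psi b
  induction a using DirectSum.Decomposition.inductionOn (piece (degJoint l)) with
  | zero => simp only [map_zero, zero_mul]
  | add a a' h h' => simp only [map_add, add_mul, h, h']
  | homogeneous a =>
    induction b using DirectSum.Decomposition.inductionOn (piece (degJoint l)) with
    | zero => simp only [map_zero, mul_zero]
    | add b b' h h' => simp only [map_add, mul_add, h, h']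
    | homogeneous b =>
      rw [Psi_mul_Psi a.2 b.2, map_smul, map_smul, comulBar_Psi_eq, comulBar_Psi_eq,
        comulBar_Psi_eq, of_twistPsi_mul (comul_mem_tensorSpace a.2) (comul_mem_tensorSpace b.2),
        map_mul]

lemma comulBar_one : comulBar l 1 = 1 ⊗ₜ 1 := by
  have h1 := one_mem_jointSpace (l := l)
  conv_lhs => rw [← Psi_one, comulBar_Psi_eq, map_one, Algebra.TensorProduct.one_def,
    twistPsi_tmul h1 h1, map_zero, formQ_zero_left, sgn_zero, one_smul, Psi_one]

/-! ### Coassociativity and counit -/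

/-- The linear map `x ↦ (-1) ^ (ν, ν(x) + η(ν(x))) x`. -/
def twistBy (ν : P l) : Ut l →ₗ[kk] Ut l :=
  gradedMap weightSpace fun ν' => sgn (formQ (red l ν) (red l ν' + η ν')) • LinearMap.id

lemma twistBy_of_mem {ν ν' : P l} {x : Ut l} (hx : x ∈ weightSpace ν') :
    twistBy ν x = sgn (formQ (red l ν) (red l ν' + η ν')) • x := by
  rw [twistBy, gradedMap_of_mem _ _ hx, LinearMap.smul_apply, LinearMap.id_apply]

/-- The analogue of `twistPsi` for three factors: the sign is the product of those for the three
pairs of factors. -/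
def twistPsi₃ (l : ℕ) : Ut l ⊗[kk] (Ut l ⊗[kk] Ut l) →ₗ[kk] Ut l ⊗[kk] (Ut l ⊗[kk] Ut l) :=
  TensorProduct.lift (gradedMap weightSpace fun ν =>
    (TensorProduct.mk kk (Ut l) (Ut l ⊗[kk] Ut l)).compl₁₂ (Psi l)
      (twistPsi l ∘ₗ TensorProduct.map (twistBy ν) (twistBy ν)))

lemma twistPsi₃_tmul {ν₁ ν₂ ν₃ : P l} {θ₁ θ₂ θ₃ : Q l} {x y z : Ut l} (hx : x ∈ jointSpace ν₁ θ₁)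
    (hy : y ∈ jointSpace ν₂ θ₂) (hz : z ∈ jointSpace ν₃ θ₃) :
    twistPsi₃ l (x ⊗ₜ (y ⊗ₜ z)) = sgn (formQ (red l ν₁) (red l ν₂ + η ν₂) +
      formQ (red l ν₁) (red l ν₃ + η ν₃) + formQ (red l ν₂) (red l ν₃ + η ν₃)) •
        Psi l x ⊗ₜ (Psi l y ⊗ₜ Psi l z) := by
  rw [twistPsi₃, TensorProduct.lift.tmul, gradedMap_of_mem _ _ (jointSpace_le_weightSpace hx),
    LinearMap.compl₁₂_apply, LinearMap.comp_apply, TensorProduct.map_tmul,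
    twistBy_of_mem (jointSpace_le_weightSpace hy), twistBy_of_mem (jointSpace_le_weightSpace hz),
    TensorProduct.smul_tmul_smul, map_smul, twistPsi_tmul hy hz, smul_smul, ← sgn_add, ← sgn_add,
    map_smul, TensorProduct.mk_apply]

/-- The terms u ⊗ v of Δ x satisfy ν(u) + ν(v) = ν(x), so the sign of the pair (x, y) is the product
of those of (u, y) and (v, y). Together with the sign of (u, v) this is the three-factor sign. -/
lemma assoc_rTensor_twistPsi {ν : P l} {θ : Q l} {X : Ut l ⊗[kk] Ut l}
    (hX : X ∈ tensorSpace ν θ) :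
    TensorProduct.assoc kk (Ut l) (Ut l) (Ut l) ((comulBar l).rTensor (Ut l) (twistPsi l X)) =
      twistPsi₃ l (TensorProduct.assoc kk (Ut l) (Ut l) (Ut l)
        ((comul l).toLinearMap.rTensor (Ut l) X)) := by
  refine eq_of_mem_tensorSpace (f := (TensorProduct.assoc kk (Ut l) (Ut l) (Ut l)).toLinearMap ∘ₗ
    (comulBar l).rTensor (Ut l) ∘ₗ twistPsi l) (g := twistPsi₃ l ∘ₗ
    (TensorProduct.assoc kk (Ut l) (Ut l) (Ut l)).toLinearMap ∘ₗ
      (comul l).toLinearMap.rTensor (Ut l)) (fun ν₁ ν₂ x y _ hx hy => ?_) hX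
  simp only [LinearMap.comp_apply, LinearEquiv.coe_coe, twistPsi_tmul hx hy, map_smul,
    LinearMap.rTensor_tmul, comulBar_Psi_eq, AlgHom.toLinearMap_apply]
  -- With x and y fixed, the same reduction to generating tensors is now applied to Δ x.
  refine eq_of_mem_tensorSpace (f := sgn (formQ (red l ν₁) (red l ν₂ + η ν₂)) •
    (TensorProduct.assoc kk (Ut l) (Ut l) (Ut l)).toLinearMap ∘ₗ
      (TensorProduct.mk kk (Ut l ⊗[kk] Ut l) (Ut l)).flip (Psi l y) ∘ₗ twistPsi l)
    (g := twistPsi₃ l ∘ₗ (TensorProduct.assoc kk (Ut l) (Ut l) (Ut l)).toLinearMap ∘ₗ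
      (TensorProduct.mk kk (Ut l ⊗[kk] Ut l) (Ut l)).flip y) (fun ν₃ ν₄ u v e hu hv => ?_)
      (comul_mem_tensorSpace hx)
  simp only [LinearMap.smul_apply, LinearMap.comp_apply, LinearEquiv.coe_coe, LinearMap.flip_apply,
    TensorProduct.mk_apply, TensorProduct.assoc_tmul, twistPsi₃_tmul hu hv hy, twistPsi_tmul hu hv,
    map_smul, smul_smul, ← sgn_add, ← e, map_add, formQ_add_left]
  congr 2
  abel

/-- Here the second factor is split, and the sign of (x, y) decomposes because ν + η(ν) is additive
in the second slot. The resulting three-factor sign is the one of `assoc_rTensor_twistPsi`, so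
coassociativity of Δ̄ reduces to that of Δ. -/
lemma lTensor_twistPsi {ν : P l} {θ : Q l} {X : Ut l ⊗[kk] Ut l} (hX : X ∈ tensorSpace ν θ) :
    (comulBar l).lTensor (Ut l) (twistPsi l X) =
      twistPsi₃ l ((comul l).toLinearMap.lTensor (Ut l) X) := by
  refine eq_of_mem_tensorSpace (f := (comulBar l).lTensor (Ut l) ∘ₗ twistPsi l)
    (g := twistPsi₃ l ∘ₗ (comul l).toLinearMap.lTensor (Ut l)) (fun ν₁ ν₂ x y _ hx hy => ?_) hX
  simp only [LinearMap.comp_apply, twistPsi_tmul hx hy, map_smul,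
    LinearMap.lTensor_tmul, comulBar_Psi_eq, AlgHom.toLinearMap_apply]
  refine eq_of_mem_tensorSpace (f := sgn (formQ (red l ν₁) (red l ν₂ + η ν₂)) •
      TensorProduct.mk kk (Ut l) (Ut l ⊗[kk] Ut l) (Psi l x) ∘ₗ twistPsi l)
    (g := twistPsi₃ l ∘ₗ TensorProduct.mk kk (Ut l) (Ut l ⊗[kk] Ut l) x)
    (fun ν₃ ν₄ u v e hu hv => ?_) (comul_mem_tensorSpace hy)
  simp only [LinearMap.smul_apply, LinearMap.comp_apply, TensorProduct.mk_apply,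
    twistPsi₃_tmul hx hu hv, twistPsi_tmul hu hv, TensorProduct.tmul_smul, smul_smul, ← sgn_add,
    ← e, η_add, map_add, formQ_add_right]
  congr 2
  abel

set_option synthInstance.maxHeartbeats 200000 in
lemma comulBar_coassoc (a : Ut l) :
    TensorProduct.assoc kk (Ut l) (Ut l) (Ut l) ((comulBar l).rTensor (Ut l) (comulBar l a)) =
      (comulBar l).lTensor (Ut l) (comulBar l a) := by
  obtain ⟨a, rfl⟩ := exists_Psi a
  induction a using DirectSum.Decomposition.inductionOn (piece (degJoint l)) with
  | zero => simp only [map_zero]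
  | add a a' h h' => simp only [map_add, h, h']
  | homogeneous a =>
    have h := comul_mem_tensorSpace a.2
    rw [comulBar_Psi_eq, assoc_rTensor_twistPsi h, lTensor_twistPsi h, comul_coassoc]

/-! ### The counit identities of Δ̄. -/

lemma counit_eq_zero_of_weight {ν : P l} {x : Ut l} (hx : x ∈ weightSpace ν) (hν : ν ≠ 0) :
    counit l x = 0 := by
  obtain ⟨i, hi⟩ := Function.ne_iff.1 hν
  -- Conjugation by K_{β_i} multiplies x by q^{ν_i} and does not change its counit, so ε(x) =
  -- q^{ν_i} ε(x); and q is not a root of unity.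
  have h := congrArg (counit l) (hx (β i))
  rw [map_mul, map_mul, counit_tK, counit_tK, one_mul, mul_one, map_smul, form_β, smul_eq_mul] at h
  by_contra h0
  have h2 : q ^ ν i = q ^ (0 : ℤ) := by
    rw [zpow_zero]
    exact (mul_eq_right₀ h0).1 h.symm
  exact hi (q_zpow_injective h2)

/-- Only the terms whose first factor has weight 0 survive, and for these the sign is trivial. -/
lemma lid_rTensor_twistPsi {ν : P l} {θ : Q l} {X : Ut l ⊗[kk] Ut l} (hX : X ∈ tensorSpace ν θ) :
    TensorProduct.lid kk (Ut l) ((counit l).toLinearMap.rTensor (Ut l) (twistPsi l X)) =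
      Psi l (TensorProduct.lid kk (Ut l) ((counit l).toLinearMap.rTensor (Ut l) X)) := by
  refine eq_of_mem_tensorSpace (f := (TensorProduct.lid kk (Ut l)).toLinearMap ∘ₗ
      (counit l).toLinearMap.rTensor (Ut l) ∘ₗ twistPsi l)
    (g := Psi l ∘ₗ (TensorProduct.lid kk (Ut l)).toLinearMap ∘ₗ
      (counit l).toLinearMap.rTensor (Ut l)) (fun ν₁ ν₂ x y _ hx hy => ?_) hX
  simp only [LinearMap.comp_apply, LinearEquiv.coe_coe, twistPsi_tmul hx hy, map_smul,
    LinearMap.rTensor_tmul, AlgHom.toLinearMap_apply, counit_Psi, TensorProduct.lid_tmul]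
  by_cases h : ν₁ = 0
  · rw [h, map_zero, formQ_zero_left, sgn_zero, one_smul]
  · rw [counit_eq_zero_of_weight (jointSpace_le_weightSpace hx) h, zero_smul, smul_zero]

lemma rid_lTensor_twistPsi {ν : P l} {θ : Q l} {X : Ut l ⊗[kk] Ut l} (hX : X ∈ tensorSpace ν θ) :
    TensorProduct.rid kk (Ut l) ((counit l).toLinearMap.lTensor (Ut l) (twistPsi l X)) =
      Psi l (TensorProduct.rid kk (Ut l) ((counit l).toLinearMap.lTensor (Ut l) X)) := by
  refine eq_of_mem_tensorSpace (f := (TensorProduct.rid kk (Ut l)).toLinearMap ∘ₗ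
      (counit l).toLinearMap.lTensor (Ut l) ∘ₗ twistPsi l)
    (g := Psi l ∘ₗ (TensorProduct.rid kk (Ut l)).toLinearMap ∘ₗ
      (counit l).toLinearMap.lTensor (Ut l)) (fun ν₁ ν₂ x y _ hx hy => ?_) hX
  simp only [LinearMap.comp_apply, LinearEquiv.coe_coe, twistPsi_tmul hx hy, map_smul,
    LinearMap.lTensor_tmul, AlgHom.toLinearMap_apply, counit_Psi, TensorProduct.rid_tmul]
  by_cases h : ν₂ = 0
  · rw [h, η_zero, map_zero, add_zero, formQ_zero_right, sgn_zero, one_smul]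
  · rw [counit_eq_zero_of_weight (jointSpace_le_weightSpace hy) h, zero_smul, smul_zero]

lemma counit_comulBar (a : Ut l) :
    TensorProduct.lid kk (Ut l) ((counit l).toLinearMap.rTensor (Ut l) (comulBar l a)) = a := by
  obtain ⟨a, rfl⟩ := exists_Psi a
  induction a using DirectSum.Decomposition.inductionOn (piece (degJoint l)) with
  | zero => simp only [map_zero]
  | add a a' h h' => simp only [map_add, h, h']
  | homogeneous a =>
    rw [comulBar_Psi_eq, lid_rTensor_twistPsi (comul_mem_tensorSpace a.2), counit_comul]

lemma comulBar_counit (a : Ut l) :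
    TensorProduct.rid kk (Ut l) ((counit l).toLinearMap.lTensor (Ut l) (comulBar l a)) = a := by
  obtain ⟨a, rfl⟩ := exists_Psi a
  induction a using DirectSum.Decomposition.inductionOn (piece (degJoint l)) with
  | zero => simp only [map_zero]
  | add a a' h h' => simp only [map_add, h, h']
  | homogeneous a =>
    rw [comulBar_Psi_eq, rid_lTensor_twistPsi (comul_mem_tensorSpace a.2), comul_counit]

/-! ### The twisted antipode -/

lemma antipodeBar_Psi_of_mem {ν : P l} {θ : Q l} {x : Ut l} (hx : x ∈ jointSpace ν θ) :
    antipodeBar l (Psi l x) = sgn (formQ (red l ν) θ) • Psi l (antipode l x) :=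
  antipodeBar_Psi (jointSpace_le_weightSpace hx) (jointSpace_le_deltaSpace hx)

/-- Three exponents add up: (ν₁, ν₂ + η(ν₂)) from the coproduct, (ν₁, θ + ν₂) from S̄ and (θ +
η(ν₂), ν₁) from the product. Each term occurs twice, so the sum is 0 modulo 2. -/
lemma mul_antipodeBar_rTensor_twistPsi {ν : P l} {θ : Q l} {X : Ut l ⊗[kk] Ut l}
    (hX : X ∈ tensorSpace ν θ) :
    LinearMap.mul' kk (Ut l) ((antipodeBar l).rTensor (Ut l) (twistPsi l X)) =
      Psi l (LinearMap.mul' kk (Ut l) ((antipode l).rTensor (Ut l) X)) := by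
  refine eq_of_mem_tensorSpace (f := LinearMap.mul' kk (Ut l) ∘ₗ
      (antipodeBar l).rTensor (Ut l) ∘ₗ twistPsi l)
    (g := Psi l ∘ₗ LinearMap.mul' kk (Ut l) ∘ₗ (antipode l).rTensor (Ut l))
    (fun ν₁ ν₂ x y _ hx hy => ?_) hX
  simp only [LinearMap.comp_apply, twistPsi_tmul hx hy, map_smul, LinearMap.rTensor_tmul,
    LinearMap.mul'_apply, antipodeBar_Psi_of_mem hx, smul_mul_assoc,
    Psi_mul_Psi (antipode_mem_jointSpace hx) hy, smul_smul, ← sgn_add]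
  convert one_smul kk _
  rw [← sgn_zero]
  congr 1
  simp only [formQ_add_left, formQ_add_right]
  grind [formQ_comm]

/-- Now S y has δ-degree θ + ν₂, and the exponents (ν₁, ν₂ + η(ν₂)), (ν₂, θ) and (θ + ν₂ + η(ν₂),
ν₁) add up to (ν₁ + ν₂, θ). The cancellation is not complete, but the remaining sign depends only on
the total degrees. -/
lemma mul_antipodeBar_lTensor_twistPsi {ν : P l} {θ : Q l} {X : Ut l ⊗[kk] Ut l}
    (hX : X ∈ tensorSpace ν θ) :
    LinearMap.mul' kk (Ut l) ((antipodeBar l).lTensor (Ut l) (twistPsi l X)) =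
      sgn (formQ (red l ν) θ) •
        Psi l (LinearMap.mul' kk (Ut l) ((antipode l).lTensor (Ut l) X)) := by
  refine eq_of_mem_tensorSpace (f := LinearMap.mul' kk (Ut l) ∘ₗ
      (antipodeBar l).lTensor (Ut l) ∘ₗ twistPsi l)
    (g := sgn (formQ (red l ν) θ) •
      Psi l ∘ₗ LinearMap.mul' kk (Ut l) ∘ₗ (antipode l).lTensor (Ut l))
    (fun ν₁ ν₂ x y e hx hy => ?_) hX
  simp only [LinearMap.smul_apply, LinearMap.comp_apply, twistPsi_tmul hx hy, map_smul,
    LinearMap.lTensor_tmul, LinearMap.mul'_apply, antipodeBar_Psi_of_mem hy, mul_smul_comm,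
    Psi_mul_Psi hx (antipode_mem_jointSpace hy), smul_smul, ← sgn_add]
  congr 2
  simp only [← e, map_add, formQ_add_left, formQ_add_right]
  grind [formQ_comm]

lemma Psi_algebraMap (c : kk) : Psi l (algebraMap kk (Ut l) c) = algebraMap kk (Ut l) c := by
  rw [Algebra.algebraMap_eq_smul_one, map_smul, Psi_one]

lemma mul_antipodeBar_rTensor_comulBar (a : Ut l) :
    LinearMap.mul' kk (Ut l) ((antipodeBar l).rTensor (Ut l) (comulBar l a)) =
      algebraMap kk (Ut l) (counit l a) := by
  obtain ⟨a, rfl⟩ := exists_Psi a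
  induction a using DirectSum.Decomposition.inductionOn (piece (degJoint l)) with
  | zero => simp only [map_zero]
  | add a a' h h' => simp only [map_add, h, h']
  | homogeneous a =>
    rw [comulBar_Psi_eq, mul_antipodeBar_rTensor_twistPsi (comul_mem_tensorSpace a.2),
      mul_antipode_rTensor_comul, Psi_algebraMap, counit_Psi]

lemma mul_antipodeBar_lTensor_comulBar (a : Ut l) :
    LinearMap.mul' kk (Ut l) ((antipodeBar l).lTensor (Ut l) (comulBar l a)) =
      algebraMap kk (Ut l) (counit l a) := by
  obtain ⟨a, rfl⟩ := exists_Psi a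
  induction a using DirectSum.Decomposition.inductionOn (piece (degJoint l)) with
  | zero => simp only [map_zero]
  | add a a' h h' => simp only [map_add, h, h']
  | @homogeneous m a =>
    rw [comulBar_Psi_eq, mul_antipodeBar_lTensor_twistPsi (comul_mem_tensorSpace a.2),
      mul_antipode_lTensor_comul, Psi_algebraMap, counit_Psi]
    -- The remaining sign is harmless: it is 1 in weight 0, and in any other weight the counit
    -- vanishes.
    by_cases h : m.1 = 0
    · rw [h, map_zero, formQ_zero_left, sgn_zero, one_smul]
    · rw [counit_eq_zero_of_weight (jointSpace_le_weightSpace a.2) h, map_zero, smul_zero]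

/-! ### Parity -/

/-- The homogeneous components of `Ψ x` for the `ℤ / 2ℤ`-gradation are `Ψ x` and `0`. -/
lemma decompose_Psi {ν : P l} {θ : Q l} {x : Ut l} (hx : x ∈ jointSpace ν θ) (i : ZMod 2) :
    (DirectSum.decompose (parity l) (Psi l x) i : Ut l) =
      if ((form ν (wlast l) : ℤ) : ZMod 2) = i then Psi l x else 0 := by
  rw [DirectSum.decompose_of_mem _ (Psi_mem_parity hx), DirectSum.coe_of_apply]
  split_ifs <;> rfl

/-- Every x is Ψ a, and Ψ sends each bihomogeneous component of a to an element of a single parity.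
Hence the part of x of parity i is the sum of Ψ over the components of a whose weight has that
parity. -/
lemma parity_le {i : ZMod 2} {N : Submodule kk (Ut l)}
    (h : ∀ ν θ, ((form ν (wlast l) : ℤ) : ZMod 2) = i → ∀ x ∈ jointSpace ν θ, Psi l x ∈ N) :
    parity l i ≤ N := by
  have key : ∀ a, (DirectSum.decompose (parity l) (Psi l a) i : Ut l) ∈ N := by
    intro a
    induction a using DirectSum.Decomposition.inductionOn (piece (degJoint l)) with
    | zero => simp
    | add a a' h h' =>
      rw [map_add, DirectSum.decompose_add, DirectSum.add_apply, Submodule.coe_add]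
      exact Submodule.add_mem _ h h'
    | homogeneous a =>
      rw [decompose_Psi a.2]
      split_ifs with hi
      · exact h _ _ hi _ a.2
      · exact Submodule.zero_mem _
  intro x hx
  obtain ⟨a, rfl⟩ := exists_Psi x
  have := key a
  rwa [DirectSum.decompose_of_mem_same _ hx] at this

lemma comulBar_even (i : ZMod 2) (a : Ut l) (ha : a ∈ parity l i) :
    comulBar l a ∈ ⨆ j : ZMod 2, LinearMap.range
      (TensorProduct.map (parity l j).subtype (parity l (i - j)).subtype) := by
  rw [← Submodule.mem_comap]
  refine parity_le (fun ν θ hν x hx => ?_) ha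
  rw [Submodule.mem_comap, comulBar_Psi_eq, ← Submodule.mem_comap]
  refine (Submodule.span_le (R := kk)).2 ?_ (comul_mem_tensorSpace hx)
  rintro _ ⟨ν₁, ν₂, x, y, rfl, hx, hy, rfl⟩
  rw [SetLike.mem_coe, Submodule.mem_comap, twistPsi_tmul hx hy]
  refine Submodule.smul_mem _ _ (Submodule.mem_iSup_of_mem (form ν₁ (wlast l) : ZMod 2) ?_)
  -- The index j of the summand is the parity of the first factor; by additivity of the weight, i -
  -- j is then the parity of the second.
  have h2 : i - ((form ν₁ (wlast l) : ℤ) : ZMod 2) = ((form ν₂ (wlast l) : ℤ) : ZMod 2) := by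
    rw [← hν, form_add_left, Int.cast_add, add_sub_cancel_left]
  exact ⟨⟨_, Psi_mem_parity hx⟩ ⊗ₜ ⟨_, h2 ▸ Psi_mem_parity hy⟩, rfl⟩

lemma antipodeBar_even (i : ZMod 2) (a : Ut l) (ha : a ∈ parity l i) :
    antipodeBar l a ∈ parity l i := by
  rw [← Submodule.mem_comap]
  refine parity_le (fun ν θ hν x hx => ?_) ha
  rw [Submodule.mem_comap, antipodeBar_Psi_of_mem hx, ← hν]
  exact Submodule.smul_mem _ _ (Psi_mem_parity (antipode_mem_jointSpace hx))

/-- Conjugation by ξ negates an odd element and preserves its counit, and 2 is invertible in k. -/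
lemma counit_even (a : Ut l) (ha : a ∈ parity l 1) : counit l a = 0 := by
  have h := congrArg (counit l) (mem_parity.1 ha)
  rw [map_mul, map_mul, xiLast, counit_xi, one_mul, mul_one, map_smul, sgn_one, neg_one_smul] at h
  exact self_eq_neg.1 h

/-! ### The image of `U` -/

/-- The subspace `U` of `Ũ` is spanned by its homogeneous elements. -/
lemma range_incl_le :
    LinearMap.range (incl l).toLinearMap ≤
      ⨆ m : P l × Q l, jointSpace m.1 m.2 ⊓ LinearMap.range (incl l).toLinearMap := by
  rintro _ ⟨u, rfl⟩
  rw [AlgHom.toLinearMap_apply]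
  have hle := le_iSup (fun m : P l × Q l =>
    jointSpace m.1 m.2 ⊓ LinearMap.range (incl l).toLinearMap)
  induction u using U_induction with
  | hE i => exact hle (_, _) ⟨tE_mem_jointSpace i, _, rfl⟩
  | hF i => exact hle (_, _) ⟨tF_mem_jointSpace i, _, rfl⟩
  | hK μ => exact hle (_, _) ⟨tK_mem_jointSpace μ, _, rfl⟩
  | hc c =>
    rw [AlgHom.commutes, Algebra.algebraMap_eq_smul_one]
    exact Submodule.smul_mem _ _ (hle (_, _) ⟨one_mem_jointSpace, 1, map_one (incl l)⟩)
  | hadd a b ha hb => rw [map_add]; exact Submodule.add_mem _ ha hb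
  | hmul a b ha hb =>
    rw [map_mul]
    have h := Submodule.mul_mem_mul ha hb
    simp only [Submodule.iSup_mul, Submodule.mul_iSup] at h
    refine (iSup_le fun m => iSup_le fun m' => Submodule.mul_le.2 ?_ : _ ≤ _) h
    rintro x ⟨hx, u, rfl⟩ y ⟨hy, v, rfl⟩
    exact hle (_, _) ⟨mul_mem_jointSpace hx hy, u * v, map_mul (incl l) u v⟩

/-- A subspace contains `Ψ(U)` as soon as it contains the images of the homogeneous elements. -/
lemma Ubar_le {N : Submodule kk (Ut l)}
    (h : ∀ ν θ u, incl l u ∈ jointSpace ν θ → Psi l (incl l u) ∈ N) : Ubar l ≤ N := by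
  rw [Ubar, Submodule.map_le_iff_le_comap]
  refine range_incl_le.trans (iSup_le ?_)
  rintro m _ ⟨hx, u, rfl⟩
  exact h _ _ u hx

lemma Psi_incl_mem_Ubar (u : U l) : Psi l (incl l u) ∈ Ubar l :=
  Submodule.mem_map_of_mem ⟨u, rfl⟩

lemma one_mem_Ubar : (1 : Ut l) ∈ Ubar l := by
  have h := Psi_incl_mem_Ubar (1 : U l)
  rwa [map_one, Psi_one] at h

/-- The formula for Ψ(x) Ψ(y) needs both factors homogeneous, so the reduction to homogeneous
elements is made for one factor and then for the other. -/
lemma mul_mem_Ubar {a b : Ut l} (ha : a ∈ Ubar l) (hb : b ∈ Ubar l) : a * b ∈ Ubar l := by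
  have h : Ubar l ≤ (Ubar l).comap (LinearMap.mulRight kk b) := by
    refine Ubar_le fun ν θ u hu => ?_
    have h : Ubar l ≤ (Ubar l).comap (LinearMap.mulLeft kk (Psi l (incl l u))) := by
      refine Ubar_le fun ν' θ' v hv => ?_
      rw [Submodule.mem_comap, LinearMap.mulLeft_apply, Psi_mul_Psi hu hv, ← map_mul]
      exact Submodule.smul_mem _ _ (Psi_incl_mem_Ubar _)
    exact h hb
  exact h ha

lemma decompose_mem_Ubar {b : Ut l} (hb : b ∈ Ubar l) (i : ZMod 2) :
    (DirectSum.decompose (parity l) b i : Ut l) ∈ Ubar l := by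
  have h : Ubar l ≤ (Ubar l).comap (GradedAlgebra.proj (parity l) i) := by
    refine Ubar_le fun ν θ u hu => ?_
    rw [Submodule.mem_comap, GradedAlgebra.proj_apply, decompose_Psi hu]
    split_ifs
    · exact Psi_incl_mem_Ubar u
    · exact Submodule.zero_mem _
  exact h hb

lemma antipodeBar_mem_Ubar {b : Ut l} (hb : b ∈ Ubar l) : antipodeBar l b ∈ Ubar l := by
  have h : Ubar l ≤ (Ubar l).comap (antipodeBar l) := by
    refine Ubar_le fun ν θ u hu => ?_
    -- The antipode of Ũ restricts to that of U.
    have hS : antipode l (incl l u) = incl l (antipodeU l u).unop := by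
      simp [antipode, antipodeOp, liftUt_incl]
    rw [Submodule.mem_comap, antipodeBar_Psi_of_mem hu, hS]
    exact Submodule.smul_mem _ _ (Psi_incl_mem_Ubar _)
  exact h hb

/-- The sign in `twistPsi` is a scalar only on tensors of weight elements. Both factors are
therefore replaced, one at a time, by bihomogeneous elements that still lie in U. -/
lemma twistPsi_incl_mem (u v : U l) : twistPsi l (incl l u ⊗ₜ incl l v) ∈
    LinearMap.range (TensorProduct.map (Ubar l).subtype (Ubar l).subtype) := by
  have h1 : LinearMap.range (incl l).toLinearMap ≤
      (LinearMap.range (TensorProduct.map (Ubar l).subtype (Ubar l).subtype)).comap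
        (twistPsi l ∘ₗ (TensorProduct.mk kk (Ut l) (Ut l)).flip (incl l v)) := by
    refine range_incl_le.trans (iSup_le ?_)
    rintro m _ ⟨hx, u, rfl⟩
    have h2 : LinearMap.range (incl l).toLinearMap ≤
        (LinearMap.range (TensorProduct.map (Ubar l).subtype (Ubar l).subtype)).comap
          (twistPsi l ∘ₗ TensorProduct.mk kk (Ut l) (Ut l) (incl l u)) := by
      refine range_incl_le.trans (iSup_le ?_)
      rintro m' _ ⟨hy, v, rfl⟩
      rw [Submodule.mem_comap, LinearMap.comp_apply, TensorProduct.mk_apply]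
      refine (twistPsi_tmul hx hy).symm ▸ Submodule.smul_mem _ _ ?_
      exact ⟨⟨_, Psi_incl_mem_Ubar u⟩ ⊗ₜ ⟨_, Psi_incl_mem_Ubar v⟩, rfl⟩
    exact h2 ⟨v, rfl⟩
  exact h1 ⟨u, rfl⟩

/-- The coproduct of Ũ restricts to that of U, so Δ u is a sum of tensors of elements of U, and
`twistPsi_incl_mem` applies to each of them. -/
lemma comulBar_mem_Ubar {b : Ut l} (hb : b ∈ Ubar l) : comulBar l b ∈
    LinearMap.range (TensorProduct.map (Ubar l).subtype (Ubar l).subtype) := by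
  obtain ⟨_, ⟨u, rfl⟩, rfl⟩ := hb
  have h : comul l (incl l u) = Algebra.TensorProduct.map (incl l) (incl l) (comulU l u) := by
    rw [comul, liftUt_incl, AlgHom.comp_apply]
  rw [comulBar_Psi_eq, AlgHom.toLinearMap_apply, h]
  induction comulU l u using TensorProduct.induction_on with
  | zero => simp only [map_zero, Submodule.zero_mem]
  | tmul u v => exact twistPsi_incl_mem u v
  | add X Y hX hY => simpa only [map_add] using Submodule.add_mem _ hX hY

end

end ZhangOsp

theorem mainTheorem6 (l : ℕ) (hl : 1 ≤ l) :
    ZhangOsp.IsHopfSuperalgebra (ZhangOsp.parity l) (ZhangOsp.comulBar l)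
      (ZhangOsp.counit l).toLinearMap (ZhangOsp.antipodeBar l) ∧
    ZhangOsp.IsHopfSubsuperalgebra (ZhangOsp.parity l) (ZhangOsp.comulBar l)
      (ZhangOsp.antipodeBar l) (ZhangOsp.Ubar l) := by
  refine ⟨?_, ?_⟩
  · exact
      { comul_even := ZhangOsp.comulBar_even
        comul_one := ZhangOsp.comulBar_one
        comul_mul := ZhangOsp.comulBar_mul
        counit_even := ZhangOsp.counit_even
        counit_one := map_one (ZhangOsp.counit l)
        counit_mul := map_mul (ZhangOsp.counit l)
        coassoc := ZhangOsp.comulBar_coassoc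
        counit_comul := ZhangOsp.counit_comulBar
        comul_counit := ZhangOsp.comulBar_counit
        antipode_even := ZhangOsp.antipodeBar_even
        antipode_left := ZhangOsp.mul_antipodeBar_rTensor_comulBar
        antipode_right := ZhangOsp.mul_antipodeBar_lTensor_comulBar }
  · exact
      { one_mem := ZhangOsp.one_mem_Ubar
        mul_mem := fun _ ha _ hb => ZhangOsp.mul_mem_Ubar ha hb
        homogeneous := fun _ hb i => ZhangOsp.decompose_mem_Ubar hb i
        comul_mem := fun _ hb => ZhangOsp.comulBar_mem_Ubar hb
        antipode_mem := fun _ hb => ZhangOsp.antipodeBar_mem_Ubar hb }
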